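/- Let $\mathbb{F}_2(D)$ be the field of rational functions in the delay variable $D$ over $\mathbb{F}_2$. Over a frame with qubit set $Q$, a row $[z(D)\,|\,x(D)]$ with $z,x\in\mathbb{F}_2(D)^Q$ represents a shift-invariant Pauli sequence up to phase; it has finite weight if its entries are Laurent polynomials. A *finite-depth gate* is one of the following shift-invariant Clifford gates, given by its action on rows ($l\in\mathbb{Z}$): CNOT from $i$ to $j\neq i$ with delay $l$ ($x_j\mathrel{+}=D^l x_i$, $z_i\mathrel{+}=D^{-l}z_j$); Hadamard on $i$ ($x_i\leftrightarrow z_i$); phase on $i$ ($z_i\mathrel{+}=x_i$); controlled-phase from $i$ to $j\ne i$ with delay $l$ ($z_j\mathrel{+}=D^l x_i$, $z_i\mathrel{+}=D^{-l}x_j$); controlled-phase from $i$ to itself with delay $l\neq0$ ($z_i\mathrel{+}=(D^l+D^{-l})x_i$). An *infinite-depth gate* on $i$, for a nonzero Laurent polynomial $f$, maps $x_i\mapsto x_i/f(D)$ and $z_i\mapsto f(D^{-1})z_i$. A circuit is a finite sequence of gates; it is *online* if there is a bound on the number of consecutive frames on which the repeated elementary step of each gate acts ($|l|+1$ frames for a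 gate with delay $l$, one frame for a Hadamard or phase gate, $\deg f-\operatorname{del} f+1$ frames for the infinite-depth gate of $f$). **Theorem.** Let $n,c,a\ge 0$ and $k$ be integers with $a=n-k-2c$, and let $H(D)=[Z(D)\,|\,X(D)]$ be an $(n-k)\times 2n$ matrix over $\mathbb{F}_2(D)$ with linearly independent rows whose shifted symplectic product matrix is $$Z(D)X^T(D^{-1})+X(D)Z^T(D^{-1})=\bigoplus_{i=1}^{c}J\ \oplus\ \bigoplus_{j=1}^{a}[0],\qquad J=\begin{bmatrix}0&1\\1&0\end{bmatrix}.$$ Then $k+c\ge 0$, and the following holds for some assignment of roles to the sender's qubits. In each frame the sender holds $n$ qubits, namely $c$ halves of ebits whose other halves are $c$ qubits held by the receiver, $a$ ancillas, and $k+c$ information qubits. Let $S_0(D)$ be the stabilizer matrix of the unencoded stream (rows $ZZ$ and $XX$ for each ebit and $Z$ for each ancilla), and let $I_0(D)$ be its information-qubit matrix (rows $Z$ and $X$ for each information qubit). There are 1. an online encoding circuit of finite-depth and infinite-depth gates, acting on the sender's $n$ qubits only, that maps $S_0$ to a matrix whose restriction to the sender's qubits is equal to $H(D)$ up to left multiplication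 by an invertible matrix over $\mathbb{F}_2(D)$ (that is, up to row operations); and 2. an online decoding circuit of finite-depth gates only, acting on all $c+n$ qubits of the frame, which maps rows of finite weight to rows of finite weight and recovers the information qubits: if encoding followed by decoding maps $S_0$ to $S_1$ and $I_0$ to $I_1$, then $I_1=I_0+L\,S_1$ for some matrix $L$ of Laurent polynomials (that is, the logical operators have their original form up to multiplication by stabilizer elements). Thus the code encodes $k+c$ information qubits per frame with the help of $c$ ebits and $a$ ancilla qubits. -/

import Mathlib

noncomputable section

namespace QConv

open Polynomial

/-- Binary rational functions `ℤ₂(D)` in the delay operator `D`. -/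
abbrev K : Type := RatFunc (ZMod 2)

/-- The delay operator. -/
def D : K := RatFunc.X

lemma D_ne_zero : D ≠ 0 := RatFunc.X_ne_zero

/-- Finite-degree, finite-delay binary polynomials in `D`. -/
abbrev Laurent : Type := LaurentPolynomial (ZMod 2)

/-- The inclusion of the binary Laurent polynomials in the rational functions. -/
def Laurent.toK : Laurent →+* K :=
  LaurentPolynomial.eval₂ (algebraMap (ZMod 2) K) (Units.mk0 D D_ne_zero)

lemma aeval_D_inv_injective :
    Function.Injective (Polynomial.aeval (R := ZMod 2) (D⁻¹ : K)) := by
  rw [← transcendental_iff_injective]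
  intro h
  have h2 := h.inv
  rw [inv_inv] at h2
  exact RatFunc.transcendental_X h2

/-- Time reversal: the field homomorphism `f(D) ↦ f(D⁻¹)`. -/
def timeReversal : K →+* K :=
  RatFunc.liftRingHom (Polynomial.aeval (R := ZMod 2) (D⁻¹ : K)).toRingHom (by
    intro p hp
    rw [Submonoid.mem_comap, mem_nonZeroDivisors_iff_ne_zero]
    intro h
    exact (nonZeroDivisors.ne_zero hp)
      (aeval_D_inv_injective (by simpa using h)))

/-- The shifted symplectic product matrix `Z(D) Xᵀ(D⁻¹) + X(D) Zᵀ(D⁻¹)` of the check matrix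
`[Z(D) | X(D)]`. -/
def shiftedSymplecticMatrix {ρ Q : Type} [Fintype Q] (Z X : Matrix ρ Q K) : Matrix ρ ρ K :=
  Z * (X.map timeReversal).transpose + X * (Z.map timeReversal).transpose

/-- Index set of `2c + a` generators: the generators `(0, i)` and `(1, i)` form the `i`-th pair. -/
abbrev GenIdx (c a : ℕ) : Type := (Fin 2 × Fin c) ⊕ Fin a

/-- The standard form `⨁_{i=1}^c J ⊕ ⨁_{j=1}^a [0]` with `J = [[0, 1], [1, 0]]`. -/
def standardForm (c a : ℕ) : Matrix (GenIdx c a) (GenIdx c a) K :=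
  Matrix.fromBlocks (Matrix.blockDiagonal fun _ : Fin c => !![0, 1; 1, 0]) 0 0 0

/-! ### Shift-invariant Clifford gates

A row `[z(D) | x(D)]` of a binary polynomial matrix over the qubits `Q` of a frame is a vector
indexed by `Q ⊕ Q`: `Sum.inl q` is the "Z" entry and `Sum.inr q` the "X" entry of qubit `q`. Each
gate acts in every frame; it is given by its column operation on such rows. -/

/-- Rows `[z(D) | x(D)]`. -/
abbrev Row (Q : Type) : Type := Q ⊕ Q → K

/-- Finite-depth gates of the shift-invariant Clifford group. -/
inductive FiniteGate (Q : Type) : Type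
  /-- CNOT from qubit `i` to qubit `j` in the frame delayed by `l`. -/
  | cnot (i j : Q) (hij : i ≠ j) (l : ℤ)
  /-- Hadamard gate on qubit `i`. -/
  | hadamard (i : Q)
  /-- Phase gate on qubit `i`. -/
  | phase (i : Q)
  /-- Controlled-phase gate from qubit `i` to qubit `j` in the frame delayed by `l`. -/
  | cphase (i j : Q) (hij : i ≠ j) (l : ℤ)
  /-- Controlled-phase gate from qubit `i` to qubit `i` in the frame delayed by `l`. -/
  | cphaseSelf (i : Q) (l : ℤ) (hl : l ≠ 0)

/-- Gates available to the encoder: finite-depth gates, and the infinite-depth `1/f(D)` operation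
on a qubit `i`, where `f` is a nonzero binary Laurent polynomial. -/
inductive Gate (Q : Type) : Type
  | finite (g : FiniteGate Q)
  | infinite (i : Q) (f : Laurent) (hf : f ≠ 0)

section Action

variable {Q : Type} [DecidableEq Q]

/-- Column operation of a finite-depth gate. -/
def FiniteGate.apply : FiniteGate Q → Row Q → Row Q
  | .cnot i j _ l, u =>
      u + Pi.single (Sum.inr j) (D ^ l * u (Sum.inr i))
        + Pi.single (Sum.inl i) (D ^ (-l) * u (Sum.inl j))
  | .hadamard i, u => fun s => u (Equiv.swap (Sum.inl i) (Sum.inr i) s)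
  | .phase i, u => u + Pi.single (Sum.inl i) (u (Sum.inr i))
  | .cphase i j _ l, u =>
      u + Pi.single (Sum.inl j) (D ^ l * u (Sum.inr i))
        + Pi.single (Sum.inl i) (D ^ (-l) * u (Sum.inr j))
  | .cphaseSelf i l _, u =>
      u + Pi.single (Sum.inl i) ((D ^ l + D ^ (-l)) * u (Sum.inr i))

/-- Column operation of a gate. The infinite-depth `1/f(D)` operation on qubit `i` multiplies
column `i` of the "X" matrix by `1/f(D)` and column `i` of the "Z" matrix by `f(D⁻¹)`. -/
def Gate.apply : Gate Q → Row Q → Row Q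
  | .finite g, u => g.apply u
  | .infinite i f _, u =>
      Function.update
        (Function.update u (Sum.inr i) ((Laurent.toK f)⁻¹ * u (Sum.inr i)))
        (Sum.inl i) (timeReversal (Laurent.toK f) * u (Sum.inl i))

/-- Run a circuit (first gate of the list first) on a row. -/
def runRow (C : List (Gate Q)) (u : Row Q) : Row Q :=
  C.foldl (fun v g => g.apply v) u

/-- Run a circuit on every row of a binary polynomial matrix. -/
def run {ρ : Type} (C : List (Gate Q)) (M : Matrix ρ (Q ⊕ Q) K) : Matrix ρ (Q ⊕ Q) K :=
  Matrix.of fun r => runRow C (M r)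

/-- A row of finite weight: all its entries are Laurent polynomials. -/
def FiniteWeight (u : Row Q) : Prop := ∀ s, ∃ f : Laurent, u s = Laurent.toK f

/-- A circuit is a finite-depth operation if it maps every row of finite weight to a row of finite
weight. -/
def IsFiniteDepth (C : List (Gate Q)) : Prop :=
  ∀ u : Row Q, FiniteWeight u → FiniteWeight (runRow C u)

end Action

section Circuits

variable {Q Q' : Type}

/-- Relabel the qubits of a finite-depth gate. -/
def FiniteGate.map (φ : Q ↪ Q') : FiniteGate Q → FiniteGate Q'
  | .cnot i j h l => .cnot (φ i) (φ j) (fun e => h (φ.injective e)) l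
  | .hadamard i => .hadamard (φ i)
  | .phase i => .phase (φ i)
  | .cphase i j h l => .cphase (φ i) (φ j) (fun e => h (φ.injective e)) l
  | .cphaseSelf i l h => .cphaseSelf (φ i) l h

/-- Relabel the qubits of a gate. -/
def Gate.map (φ : Q ↪ Q') : Gate Q → Gate Q'
  | .finite g => .finite (g.map φ)
  | .infinite i f h => .infinite (φ i) f h

/-- The elementary step of the gate, which is repeated frame after frame, acts on at most `N`
consecutive frames. For the `1/f(D)` operation the step is a set of CNOT gates on
`deg f - del f + 1` consecutive frames. -/
def Gate.ActsWithin (N : ℕ) : Gate Q → Prop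
  | .finite (.cnot _ _ _ l) => |l| < N
  | .finite (.hadamard _) => 0 < N
  | .finite (.phase _) => 0 < N
  | .finite (.cphase _ _ _ l) => |l| < N
  | .finite (.cphaseSelf _ l _) => |l| < N
  | .infinite _ f _ => ∀ p q : ℤ, f.coeff p ≠ 0 → f.coeff q ≠ 0 → p - q < N

/-- A circuit is online if it acts on a bounded number of frames at a time. -/
def IsOnline (C : List (Gate Q)) : Prop := ∃ N : ℕ, ∀ g ∈ C, g.ActsWithin N

end Circuits

/-! ### The unencoded and the encoded qubit stream

In each frame the receiver holds `c` qubits (`Sum.inl`) and the sender holds `n` qubits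
(`Sum.inr`). The sender's qubits are `c` halves of ebits, `a` ancillas and `m` information qubits;
`e` says which of the `n` qubits plays which role. -/

section Streams

variable {n c a m : ℕ}

/-- The qubits of a frame: those of the receiver and those of the sender. -/
abbrev FrameQubits (c n : ℕ) : Type := Fin c ⊕ Fin n

/-- The row of the Pauli operator `Z` on qubit `q`. -/
def rowZ {Q : Type} [DecidableEq Q] (q : Q) : Row Q := Pi.single (Sum.inl q) 1

/-- The row of the Pauli operator `X` on qubit `q`. -/
def rowX {Q : Type} [DecidableEq Q] (q : Q) : Row Q := Pi.single (Sum.inr q) 1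

/-- The stabilizer of the unencoded stream: `ZZ` and `XX` for each ebit, `Z` for each ancilla. -/
def initialStabilizer (e : (Fin c ⊕ Fin a) ⊕ Fin m ≃ Fin n) :
    Matrix (GenIdx c a) (FrameQubits c n ⊕ FrameQubits c n) K :=
  Matrix.of fun
    | Sum.inl (b, i) =>
        if b = 0 then rowZ (Sum.inl i) + rowZ (Sum.inr (e (Sum.inl (Sum.inl i))))
        else rowX (Sum.inl i) + rowX (Sum.inr (e (Sum.inl (Sum.inl i))))
    | Sum.inr j => rowZ (Sum.inr (e (Sum.inl (Sum.inr j))))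

/-- The information-qubit matrix of the unencoded stream: the logical operators `Z` and `X` of each
information qubit. -/
def initialInfo (e : (Fin c ⊕ Fin a) ⊕ Fin m ≃ Fin n) :
    Matrix (Fin 2 × Fin m) (FrameQubits c n ⊕ FrameQubits c n) K :=
  Matrix.of fun r =>
    if r.1 = 0 then rowZ (Sum.inr (e (Sum.inr r.2))) else rowX (Sum.inr (e (Sum.inr r.2)))

/-- The part of a matrix on the sender's qubits. -/
def senderPart {ρ : Type} (M : Matrix ρ (FrameQubits c n ⊕ FrameQubits c n) K) :
    Matrix ρ (Fin n ⊕ Fin n) K :=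
  M.submatrix id (Sum.map Sum.inr Sum.inr)

/-- A circuit of the sender, as a circuit on all qubits of the frame. -/
def onSender (C : List (Gate (Fin n))) : List (Gate (FrameQubits c n)) :=
  C.map (Gate.map Function.Embedding.inr)

/-- The encoding circuit `E`, which acts on the sender's qubits only, encodes the stream into the
code with check matrix `H`: on the sender's qubits, the encoded stabilizer and `H` agree up to row
operations, that is, up to an invertible matrix of rational functions. -/
def Encodes (e : (Fin c ⊕ Fin a) ⊕ Fin m ≃ Fin n) (E : List (Gate (Fin n)))
    (H : Matrix (GenIdx c a) (Fin n ⊕ Fin n) K) : Prop :=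
  ∃ R : Matrix (GenIdx c a) (GenIdx c a) K, IsUnit R ∧
    H = R * senderPart (run (onSender E) (initialStabilizer e))

/-- The decoding circuit `F`, which acts on all qubits of the frame, recovers the information qubits
encoded by `E`: after encoding and decoding, their logical operators have their original form up to
multiplication by (finite products of shifts of) the stabilizer generators. -/
def Decodes (e : (Fin c ⊕ Fin a) ⊕ Fin m ≃ Fin n) (E : List (Gate (Fin n)))
    (F : List (Gate (FrameQubits c n))) : Prop :=
  ∃ L : Matrix (Fin 2 × Fin m) (GenIdx c a) Laurent,
    run F (run (onSender E) (initialInfo e)) =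
      initialInfo e + L.map Laurent.toK * run F (run (onSender E) (initialStabilizer e))

end Streams

end QConv

end

noncomputable section

namespace QConv

open Polynomial

/-! Rows carry the shifted symplectic product `form`, a sesquilinear form over `K` that is Hermitian
for time reversal. The elementary operations used here preserve it: CNOTs, Hadamards, phases with
time-reversal-invariant multiplier, and scalings. Finite-depth circuits realize these operations
(except scalings) with Laurent multipliers; infinite-depth gates supply scalings and arbitrary
rational multipliers.

Appending the receiver's halves of the ebits to the rows of `H` gives rows `S`. Both halves of `S r`
contribute the same Gram matrix, so in characteristic 2 the rows of `S` are mutually orthogonal.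
Being independent as well, they number at most `c + n` (`card_le_of_isotropic`). This gives `c + a ≤
n` and leaves `m = n - c - a = k + c` information qubits.

The decoder is built before the encoder. Euclidean descent on Laurent polynomials
(`exists_finite_apply_eq_smul_rowZ`) moves an isotropic line to a single `Z` by finite-depth gates,
provided a spare qubit is available; by induction on dimension (`exists_map_isotropic`) a
finite-depth `g` sends the span of `S` into the `Z` operators off the information qubits
(`exists_decoder`). The pulled-back logical operators `g⁻¹ (initialInfo e p)` then have Laurent
entries and are orthogonal to `S`.

Adding Laurent multiples of the ebit generators removes their receiver part
(`exists_cancel_receiver`) and leaves sender rows `w`. These are symplectic pairs orthogonal to `H`,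
because adding elements of the span of `S` changes no product. Over the field `K`, a symplectic
Gram–Schmidt process (`exists_circuit_map_pairs`, `exists_encoder`) sends the pairs in `H` and `w`
to standard pairs and the remaining rows of `H` into the span of the ancilla `Z`s. The inverse
operation is the encoder: it turns the information operators into `w`, and decoding returns them up
to the Laurent multiples that were added. -/

/-! ### Laurent polynomials in the rational functions, and time reversal -/

lemma toK_T (l : ℤ) : Laurent.toK (LaurentPolynomial.T l) = D ^ l := by
  simp [Laurent.toK]

lemma toK_C (r : ZMod 2) : Laurent.toK (LaurentPolynomial.C r) = algebraMap (ZMod 2) K r := by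
  simp [Laurent.toK]

lemma toK_toLaurent (p : (ZMod 2)[X]) :
    Laurent.toK (Polynomial.toLaurent p) = algebraMap (ZMod 2)[X] K p := by
  have h : (Laurent.toK.comp Polynomial.toLaurent) = algebraMap (ZMod 2)[X] K := by
    apply Polynomial.ringHom_ext
    · intro r
      simp [toK_C]
    · simp [toK_T, D, RatFunc.algebraMap_X]
  exact congrArg (fun φ => φ p) h

lemma exists_toK_eq (f : Laurent) :
    ∃ (l : ℤ) (p : (ZMod 2)[X]), Laurent.toK f = D ^ l * algebraMap (ZMod 2)[X] K p := by
  obtain ⟨n, p, hp⟩ := LaurentPolynomial.exists_T_pow f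
  refine ⟨-n, p, ?_⟩
  rw [← toK_toLaurent, hp, map_mul, toK_T, mul_left_comm, ← zpow_add₀ D_ne_zero]
  simp

lemma toK_injective : Function.Injective Laurent.toK := by
  rw [injective_iff_map_eq_zero]
  intro f hf
  obtain ⟨n, p, hp⟩ := LaurentPolynomial.exists_T_pow f
  have h : algebraMap (ZMod 2)[X] K p = 0 := by
    rw [← toK_toLaurent, hp, map_mul, hf, zero_mul]
  have hp0 : p = 0 := by
    simpa using h
  rw [hp0, map_zero] at hp
  have := (LaurentPolynomial.isUnit_T (R := ZMod 2) n)
  exact (this.mul_left_eq_zero).1 hp.symm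

lemma exists_toK_div (a : K) :
    ∃ f g : Laurent, g ≠ 0 ∧ a = Laurent.toK f / Laurent.toK g := by
  refine ⟨Polynomial.toLaurent a.num, Polynomial.toLaurent a.denom, ?_, ?_⟩
  · simpa using a.denom_ne_zero
  · rw [toK_toLaurent, toK_toLaurent, RatFunc.num_div_denom]

lemma timeReversal_algebraMap (p : (ZMod 2)[X]) :
    timeReversal (algebraMap (ZMod 2)[X] K p) = Polynomial.aeval (D⁻¹ : K) p := by
  simp [timeReversal, RatFunc.liftRingHom_apply]

lemma timeReversal_D : timeReversal D = D⁻¹ := by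
  rw [D, ← RatFunc.algebraMap_X, timeReversal_algebraMap]
  simp [D]

lemma timeReversal_C (r : ZMod 2) : timeReversal (RatFunc.C r) = RatFunc.C r := by
  rw [← RatFunc.algebraMap_C, timeReversal_algebraMap]
  simp

lemma timeReversal_involutive (a : K) : timeReversal (timeReversal a) = a := by
  have h : timeReversal.comp timeReversal = RingHom.id K := by
    apply IsLocalization.ringHom_ext (nonZeroDivisors (ZMod 2)[X])
    apply Polynomial.ringHom_ext
    · intro r
      simp [timeReversal_C]
    · have : algebraMap (ZMod 2)[X] K X = D := RatFunc.algebraMap_X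
      simp [this, timeReversal_D]
  exact congrArg (fun φ => φ a) h

lemma timeReversal_toK (f : Laurent) :
    timeReversal (Laurent.toK f) = Laurent.toK (LaurentPolynomial.invert f) := by
  induction f using LaurentPolynomial.induction_on' with
  | add p q hp hq => simp [hp, hq]
  | C_mul_T n a =>
    simp [toK_C, toK_T, timeReversal_C, timeReversal_D]

lemma timeReversal_ne_zero {a : K} (ha : a ≠ 0) : timeReversal a ≠ 0 :=
  (_root_.map_ne_zero _).2 ha

/-- A Laurent polynomial invariant under time reversal is a constant plus a trace. -/
lemma exists_eq_C_add_trace {f : Laurent} (hf : LaurentPolynomial.invert f = f) :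
    ∃ (c : ZMod 2) (g : Laurent),
      f = LaurentPolynomial.C c + (g + LaurentPolynomial.invert g) := by
  -- The constant term together with the strictly positive part, whose mirror image supplies the
  -- negative part.
  refine ⟨f.coeff 0, AddMonoidAlgebra.ofCoeff (f.coeff.filter fun l => 0 < l), ?_⟩
  ext l
  have h : f.coeff (-l) = f.coeff l := by
    conv_rhs => rw [← hf]
    simp
  rcases lt_trichotomy l 0 with hl | rfl | hl
  · simp [hl, hl.ne, not_lt.2 hl.le, h]
  · simp
  · simp [hl, hl.ne', not_lt.2 hl.le]

/-! ### Euclidean division and denominators -/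

/-- The Laurent polynomials, as a subring of the rational functions. -/
def laurentSubring : Subring K := Laurent.toK.range

lemma mem_laurentSubring {a : K} : a ∈ laurentSubring ↔ ∃ f : Laurent, a = Laurent.toK f := by
  simp [laurentSubring, eq_comm]

lemma D_zpow_mem (l : ℤ) : D ^ l ∈ laurentSubring :=
  mem_laurentSubring.2 ⟨_, (toK_T l).symm⟩

lemma algebraMap_mem_laurentSubring (p : (ZMod 2)[X]) :
    algebraMap (ZMod 2)[X] K p ∈ laurentSubring :=
  mem_laurentSubring.2 ⟨_, (toK_toLaurent p).symm⟩

lemma timeReversal_mem {a : K} (ha : a ∈ laurentSubring) : timeReversal a ∈ laurentSubring := by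
  obtain ⟨f, rfl⟩ := mem_laurentSubring.1 ha
  exact mem_laurentSubring.2 ⟨_, timeReversal_toK f⟩

/-- The Euclidean size of a Laurent polynomial: the least degree of a polynomial associated
with it. -/
def size (a : K) : ℕ :=
  sInf {d | ∃ (l : ℤ) (p : (ZMod 2)[X]), a = D ^ l * algebraMap (ZMod 2)[X] K p ∧ p.natDegree = d}

lemma size_le (l : ℤ) (p : (ZMod 2)[X]) : size (D ^ l * algebraMap (ZMod 2)[X] K p) ≤ p.natDegree :=
  Nat.sInf_le ⟨l, p, rfl, rfl⟩

lemma exists_size_eq {a : K} (ha : a ∈ laurentSubring) :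
    ∃ (l : ℤ) (p : (ZMod 2)[X]), a = D ^ l * algebraMap (ZMod 2)[X] K p ∧ p.natDegree = size a := by
  obtain ⟨f, rfl⟩ := mem_laurentSubring.1 ha
  obtain ⟨l, p, hp⟩ := exists_toK_eq f
  exact Nat.sInf_mem
    (s := {d | ∃ (l : ℤ) (p : (ZMod 2)[X]), _ = D ^ l * algebraMap (ZMod 2)[X] K p ∧
      p.natDegree = d}) ⟨_, l, p, hp, rfl⟩

/-- Division with remainder of Laurent polynomials. -/
lemma exists_add_mul_size_lt {a b : K} (ha : a ∈ laurentSubring) (hb : b ∈ laurentSubring)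
    (hb0 : b ≠ 0) :
    ∃ q ∈ laurentSubring, a + q * b = 0 ∨ size (a + q * b) < size b := by
  obtain ⟨k, p, rfl, -⟩ := exists_size_eq ha
  obtain ⟨l, r, hr, hd⟩ := exists_size_eq hb
  have hr0 : r ≠ 0 := by
    rintro rfl
    simp [hr] at hb0
  refine ⟨-(D ^ (k - l) * algebraMap (ZMod 2)[X] K (p / r)),
    neg_mem (mul_mem (D_zpow_mem _) (algebraMap_mem_laurentSubring _)), ?_⟩
  have key : D ^ k * algebraMap (ZMod 2)[X] K p +
      -(D ^ (k - l) * algebraMap (ZMod 2)[X] K (p / r)) * b =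
      D ^ k * algebraMap (ZMod 2)[X] K (p % r) := by
    have h1 : D ^ (k - l) * D ^ l = D ^ k := by
      rw [← zpow_add₀ D_ne_zero]; simp
    have h2 : p % r = p - r * (p / r) := by
      rw [eq_sub_iff_add_eq, add_comm, EuclideanDomain.div_add_mod]
    rw [hr, h2, map_sub, map_mul, ← h1]
    ring
  rw [key]
  by_cases h0 : p % r = 0
  · left; simp [h0]
  · right
    -- Any representative of the remainder bounds its size from above, while `r` was chosen to
    -- attain the size of `b`.
    refine (size_le _ _).trans_lt ?_
    rw [← hd]
    exact Polynomial.natDegree_lt_natDegree h0 (EuclideanDomain.mod_lt p hr0)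

/-- Scales a rational row to a Laurent one, on which Euclidean descent can start. -/
lemma exists_common_denominator {ι : Type} [Finite ι] (u : ι → K) :
    ∃ d : K, d ≠ 0 ∧ ∀ i, d * u i ∈ laurentSubring := by
  obtain ⟨b, hb⟩ := IsLocalization.exist_integer_multiples_of_finite
    (nonZeroDivisors (ZMod 2)[X]) u
  refine ⟨algebraMap (ZMod 2)[X] K b, ?_, fun i => ?_⟩
  · simp
  · obtain ⟨p, hp⟩ := hb i
    have := algebraMap_mem_laurentSubring p
    rw [hp, Algebra.smul_def] at this
    exact this

instance : CharP K 2 := charP_of_injective_algebraMap (algebraMap (ZMod 2) K).injective 2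

lemma row_add_self {Q : Type} (u : Row Q) : u + u = 0 := by
  ext s
  exact CharTwo.add_self_eq_zero _

/-! ### The Hermitian form on rows -/

section Form

variable {Q : Type} [Fintype Q]

/-- The shifted symplectic product of two rows. -/
def form (u v : Row Q) : K :=
  ∑ q, (u (Sum.inl q) * timeReversal (v (Sum.inr q)) +
    u (Sum.inr q) * timeReversal (v (Sum.inl q)))

lemma form_add_left (u v w : Row Q) : form (u + v) w = form u w + form v w := by
  simp only [form, ← Finset.sum_add_distrib, Pi.add_apply]
  exact Finset.sum_congr rfl fun q _ => by ring

lemma form_add_right (u v w : Row Q) : form u (v + w) = form u v + form u w := by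
  simp only [form, ← Finset.sum_add_distrib, Pi.add_apply, map_add]
  exact Finset.sum_congr rfl fun q _ => by ring

lemma form_smul_left (a : K) (u v : Row Q) : form (a • u) v = a * form u v := by
  simp only [form, Finset.mul_sum, Pi.smul_apply, smul_eq_mul]
  exact Finset.sum_congr rfl fun q _ => by ring

lemma form_smul_right (a : K) (u v : Row Q) : form u (a • v) = timeReversal a * form u v := by
  simp only [form, Finset.mul_sum, Pi.smul_apply, smul_eq_mul, map_mul]
  exact Finset.sum_congr rfl fun q _ => by ring

lemma timeReversal_form (u v : Row Q) : timeReversal (form u v) = form v u := by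
  simp only [form, map_sum, map_add, map_mul, timeReversal_involutive]
  exact Finset.sum_congr rfl fun q _ => by ring

variable [DecidableEq Q]

lemma form_single_inl_left (i : Q) (a : K) (v : Row Q) :
    form (Pi.single (Sum.inl i) a) v = a * timeReversal (v (Sum.inr i)) := by
  simp [form, Pi.single_apply]

lemma form_single_inr_left (i : Q) (a : K) (v : Row Q) :
    form (Pi.single (Sum.inr i) a) v = a * timeReversal (v (Sum.inl i)) := by
  simp [form, Pi.single_apply]

lemma form_single_inl_right (i : Q) (a : K) (v : Row Q) :
    form v (Pi.single (Sum.inl i) a) = v (Sum.inr i) * timeReversal a := by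
  simp [form, Pi.single_apply, apply_ite]

lemma form_single_inr_right (i : Q) (a : K) (v : Row Q) :
    form v (Pi.single (Sum.inr i) a) = v (Sum.inl i) * timeReversal a := by
  simp [form, Pi.single_apply, apply_ite]

end Form

/-! ### Elementary operations with general multipliers -/

section Elementary

variable {Q : Type} [DecidableEq Q]

/-- Linear automorphisms of the space of rows. -/
abbrev RowAut (Q : Type) : Type := Row Q ≃ₗ[K] Row Q

/-- The CNOT operation from `i` to `j` with multiplier `f`. -/
def cnotEquiv (i j : Q) (hij : i ≠ j) (f : K) : RowAut Q :=
  LinearEquiv.ofInvolutive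
    { toFun := fun u => u + Pi.single (Sum.inr j) (f * u (Sum.inr i))
        + Pi.single (Sum.inl i) (timeReversal f * u (Sum.inl j))
      map_add' := fun u v => by
        simp only [Pi.add_apply, mul_add, Pi.single_add]
        abel
      map_smul' := fun a u => by
        simp only [Pi.smul_apply, smul_eq_mul, RingHom.id_apply, smul_add, ← Pi.single_smul,
          mul_left_comm] }
    (fun u => by
      ext s
      rcases s with q | q
      · by_cases hq : q = i
        · subst hq
          simp [hij.symm, add_assoc, CharTwo.add_self_eq_zero]
        · simp [hq]
      · by_cases hq : q = j
        · subst hq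
          simp [hij, add_assoc, CharTwo.add_self_eq_zero]
        · simp [hq])

lemma cnotEquiv_apply (i j : Q) (hij : i ≠ j) (f : K) (u : Row Q) :
    cnotEquiv i j hij f u = u + Pi.single (Sum.inr j) (f * u (Sum.inr i))
        + Pi.single (Sum.inl i) (timeReversal f * u (Sum.inl j)) := rfl

/-- The Hadamard operation on `i`. -/
def hadamardEquiv (i : Q) : RowAut Q :=
  LinearEquiv.funCongrLeft K K (Equiv.swap (Sum.inl i) (Sum.inr i))

lemma hadamardEquiv_apply (i : Q) (u : Row Q) (s : Q ⊕ Q) :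
    hadamardEquiv i u s = u (Equiv.swap (Sum.inl i) (Sum.inr i) s) := rfl

@[simp] lemma hadamardEquiv_inl_self (i : Q) (u : Row Q) :
    hadamardEquiv i u (Sum.inl i) = u (Sum.inr i) := by
  simp [hadamardEquiv_apply]

@[simp] lemma hadamardEquiv_inr_self (i : Q) (u : Row Q) :
    hadamardEquiv i u (Sum.inr i) = u (Sum.inl i) := by
  simp [hadamardEquiv_apply]

lemma hadamardEquiv_inl_of_ne {i q : Q} (h : q ≠ i) (u : Row Q) :
    hadamardEquiv i u (Sum.inl q) = u (Sum.inl q) := by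
  rw [hadamardEquiv_apply, Equiv.swap_apply_of_ne_of_ne] <;> simp [h]

lemma hadamardEquiv_inr_of_ne {i q : Q} (h : q ≠ i) (u : Row Q) :
    hadamardEquiv i u (Sum.inr q) = u (Sum.inr q) := by
  rw [hadamardEquiv_apply, Equiv.swap_apply_of_ne_of_ne] <;> simp [h]

/-- The phase operation on `i` with multiplier `p`. -/
def phaseEquiv (i : Q) (p : K) : RowAut Q :=
  LinearEquiv.ofInvolutive
    { toFun := fun u => u + Pi.single (Sum.inl i) (p * u (Sum.inr i))
      map_add' := fun u v => by
        simp only [Pi.add_apply, mul_add, Pi.single_add]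
        abel
      map_smul' := fun a u => by
        simp only [Pi.smul_apply, smul_eq_mul, RingHom.id_apply, smul_add, ← Pi.single_smul,
          mul_left_comm] }
    (fun u => by
      ext s
      rcases s with q | q
      · by_cases hq : q = i
        · subst hq
          simp [add_assoc, CharTwo.add_self_eq_zero]
        · simp [hq]
      · simp)

lemma phaseEquiv_apply (i : Q) (p : K) (u : Row Q) :
    phaseEquiv i p u = u + Pi.single (Sum.inl i) (p * u (Sum.inr i)) := rfl

/-- The factor by which the scaling operation of `f` on `i` multiplies each entry. -/
def scaleFactor (i : Q) (f : K) : Q ⊕ Q → K :=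
  Function.update (Function.update 1 (Sum.inr i) f⁻¹) (Sum.inl i) (timeReversal f)

lemma scaleFactor_ne_zero (i : Q) {f : K} (hf : f ≠ 0) (s : Q ⊕ Q) : scaleFactor i f s ≠ 0 := by
  rcases s with q | q
  · by_cases hq : q = i
    · subst hq; simp [scaleFactor, hf]
    · simp [scaleFactor, hq]
  · by_cases hq : q = i
    · subst hq; simp [scaleFactor, hf]
    · simp [scaleFactor, hq]

/-- The scaling operation `x ↦ x / f`, `z ↦ f(D⁻¹) z` on `i`. -/
def scaleEquiv (i : Q) (f : K) (hf : f ≠ 0) : RowAut Q :=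
  LinearEquiv.piCongrRight fun s =>
    LinearEquiv.smulOfNeZero K K (scaleFactor i f s) (scaleFactor_ne_zero i hf s)

lemma scaleEquiv_apply (i : Q) (f : K) (hf : f ≠ 0) (u : Row Q) (s : Q ⊕ Q) :
    scaleEquiv i f hf u s = scaleFactor i f s * u s := rfl

@[simp] lemma scaleEquiv_inl_self (i : Q) (f : K) (hf : f ≠ 0) (u : Row Q) :
    scaleEquiv i f hf u (Sum.inl i) = timeReversal f * u (Sum.inl i) := by
  simp [scaleEquiv_apply, scaleFactor]

@[simp] lemma scaleEquiv_inr_self (i : Q) (f : K) (hf : f ≠ 0) (u : Row Q) :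
    scaleEquiv i f hf u (Sum.inr i) = f⁻¹ * u (Sum.inr i) := by
  simp [scaleEquiv_apply, scaleFactor]

lemma scaleEquiv_inl_of_ne {i q : Q} (h : q ≠ i) (f : K) (hf : f ≠ 0) (u : Row Q) :
    scaleEquiv i f hf u (Sum.inl q) = u (Sum.inl q) := by
  simp [scaleEquiv_apply, scaleFactor, h]

lemma scaleEquiv_inr_of_ne {i q : Q} (h : q ≠ i) (f : K) (hf : f ≠ 0) (u : Row Q) :
    scaleEquiv i f hf u (Sum.inr q) = u (Sum.inr q) := by
  simp [scaleEquiv_apply, scaleFactor, h]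

/-- Two rows agree if their entries at `i` and away from `i` do. -/
lemma row_ext_at {u v : Row Q} (i : Q) (hz : u (Sum.inl i) = v (Sum.inl i))
    (hx : u (Sum.inr i) = v (Sum.inr i))
    (h : ∀ q, q ≠ i → u (Sum.inl q) = v (Sum.inl q) ∧ u (Sum.inr q) = v (Sum.inr q)) :
    u = v := by
  ext s
  rcases s with q | q
  · by_cases hq : q = i
    · exact hq ▸ hz
    · exact (h q hq).1
  · by_cases hq : q = i
    · exact hq ▸ hx
    · exact (h q hq).2

end Elementary

/-! ### Isometries, and operations local to a set of qubits -/

section Unitary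

variable (Q : Type) [Fintype Q]

/-- The automorphisms that preserve the shifted symplectic product. -/
def unitarySub : Subgroup (RowAut Q) where
  carrier := {g | ∀ u v, form (g u) (g v) = form u v}
  mul_mem' := fun {g h} hg hh u v => by
    rw [LinearEquiv.mul_apply, LinearEquiv.mul_apply, hg, hh]
  one_mem' := fun u v => rfl
  inv_mem' := fun {g} hg u v => by
    have := hg (g⁻¹ u) (g⁻¹ v)
    rwa [← LinearEquiv.mul_apply, ← LinearEquiv.mul_apply, mul_inv_cancel, eq_comm] at this

variable {Q} [DecidableEq Q]

lemma cnotEquiv_mem_unitarySub (i j : Q) (hij : i ≠ j) (f : K) :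
    cnotEquiv i j hij f ∈ unitarySub Q := by
  intro u v
  simp only [cnotEquiv_apply, form_add_left, form_add_right, form_single_inl_left,
    form_single_inr_left, form_single_inl_right, form_single_inr_right, Pi.add_apply,
    map_mul, timeReversal_involutive, ne_eq, Sum.inr.injEq, Sum.inl.injEq,
    reduceCtorEq, not_false_eq_true, Pi.single_eq_of_ne, hij, hij.symm, add_zero]
  have h2 : (2 : K) = 0 := CharTwo.two_eq_zero
  linear_combination (f * u (Sum.inr i) * timeReversal (v (Sum.inl j)) + timeReversal f *
    u (Sum.inl j) * timeReversal (v (Sum.inr i))) * h2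

lemma phaseEquiv_mem_unitarySub (i : Q) (p : K) (hp : timeReversal p = p) :
    phaseEquiv i p ∈ unitarySub Q := by
  intro u v
  simp only [phaseEquiv_apply, form_add_left, form_add_right, form_single_inl_left,
    form_single_inl_right, Pi.add_apply,
    map_mul, ne_eq, reduceCtorEq, not_false_eq_true, Pi.single_eq_of_ne, add_zero, hp]
  have h2 : (2 : K) = 0 := CharTwo.two_eq_zero
  linear_combination (p * u (Sum.inr i) * timeReversal (v (Sum.inr i))) * h2

lemma hadamardEquiv_mem_unitarySub (i : Q) : hadamardEquiv i ∈ unitarySub Q := by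
  intro u v
  refine Finset.sum_congr rfl fun q _ => ?_
  by_cases hq : q = i
  · subst hq
    simp [add_comm]
  · simp [hadamardEquiv_inl_of_ne hq, hadamardEquiv_inr_of_ne hq]

lemma scaleEquiv_mem_unitarySub (i : Q) (f : K) (hf : f ≠ 0) :
    scaleEquiv i f hf ∈ unitarySub Q := by
  intro u v
  refine Finset.sum_congr rfl fun q _ => ?_
  by_cases hq : q = i
  · subst hq
    have := timeReversal_ne_zero hf
    simp [timeReversal_involutive]
    field_simp
  · simp [scaleEquiv_inl_of_ne hq, scaleEquiv_inr_of_ne hq]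

end Unitary

section Local

variable {Q : Type}

/-- The row is trivial on the qubits in `T`. -/
def VanishesOn (T : Set Q) (u : Row Q) : Prop :=
  ∀ q ∈ T, u (Sum.inl q) = 0 ∧ u (Sum.inr q) = 0

/-- The automorphisms that act on the qubits in `T` only. -/
def localSub (T : Set Q) : Subgroup (RowAut Q) where
  carrier := {g | (∀ u, VanishesOn T u → g u = u) ∧
    ∀ u, ∀ q ∉ T, g u (Sum.inl q) = u (Sum.inl q) ∧ g u (Sum.inr q) = u (Sum.inr q)}
  mul_mem' := fun {g h} hg hh => by
    refine ⟨fun u hu => ?_, fun u q hq => ?_⟩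
    · rw [LinearEquiv.mul_apply, hh.1 u hu, hg.1 u hu]
    · have h1 := hg.2 (h u) q hq
      have h2 := hh.2 u q hq
      exact ⟨h1.1.trans h2.1, h1.2.trans h2.2⟩
  one_mem' := ⟨fun u _ => rfl, fun u q _ => ⟨rfl, rfl⟩⟩
  inv_mem' := fun {g} hg => by
    have h : ∀ u, g (g⁻¹ u) = u := fun u => g.apply_symm_apply u
    refine ⟨fun u hu => ?_, fun u q hq => ?_⟩
    · apply g.injective
      rw [h, hg.1 u hu]
    · have h1 := hg.2 (g⁻¹ u) q hq
      rw [h] at h1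
      exact ⟨h1.1.symm, h1.2.symm⟩

lemma localSub_mono {T T' : Set Q} (h : T ⊆ T') : localSub T ≤ localSub T' := fun _ hg =>
  ⟨fun u hu => hg.1 u fun q hq => hu q (h hq), fun u q hq => hg.2 u q fun hq' => hq (h hq')⟩

variable [DecidableEq Q] {T : Set Q}

lemma cnotEquiv_mem_localSub {i j : Q} (hi : i ∈ T) (hj : j ∈ T) (hij : i ≠ j) (f : K) :
    cnotEquiv i j hij f ∈ localSub T := by
  refine ⟨fun u hu => ?_, fun u q hq => ?_⟩
  · simp [cnotEquiv_apply, hu i hi, hu j hj]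
  · have h1 : q ≠ i := fun h => hq (h ▸ hi)
    have h2 : q ≠ j := fun h => hq (h ▸ hj)
    simp [cnotEquiv_apply, h1, h2]

lemma phaseEquiv_mem_localSub {i : Q} (hi : i ∈ T) (p : K) : phaseEquiv i p ∈ localSub T := by
  refine ⟨fun u hu => ?_, fun u q hq => ?_⟩
  · simp [phaseEquiv_apply, hu i hi]
  · have h1 : q ≠ i := fun h => hq (h ▸ hi)
    simp [phaseEquiv_apply, h1]

lemma hadamardEquiv_mem_localSub {i : Q} (hi : i ∈ T) : hadamardEquiv i ∈ localSub T := by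
  refine ⟨fun u hu => row_ext_at i ?_ ?_ fun q hq => ?_, fun u q hq => ?_⟩
  · simp [hu i hi]
  · simp [hu i hi]
  · exact ⟨hadamardEquiv_inl_of_ne hq u, hadamardEquiv_inr_of_ne hq u⟩
  · have h1 : q ≠ i := fun h => hq (h ▸ hi)
    exact ⟨hadamardEquiv_inl_of_ne h1 u, hadamardEquiv_inr_of_ne h1 u⟩

lemma scaleEquiv_mem_localSub {i : Q} (hi : i ∈ T) (f : K) (hf : f ≠ 0) :
    scaleEquiv i f hf ∈ localSub T := by
  refine ⟨fun u hu => row_ext_at i ?_ ?_ fun q hq => ?_, fun u q hq => ?_⟩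
  · simp [hu i hi]
  · simp [hu i hi]
  · exact ⟨scaleEquiv_inl_of_ne hq f hf u, scaleEquiv_inr_of_ne hq f hf u⟩
  · have h1 : q ≠ i := fun h => hq (h ▸ hi)
    exact ⟨scaleEquiv_inl_of_ne h1 f hf u, scaleEquiv_inr_of_ne h1 f hf u⟩

end Local

/-! ### Which elementary operations are realized by circuits -/

section Circuits

variable {Q : Type} [DecidableEq Q]

lemma FiniteGate.apply_cnot (i j : Q) (hij : i ≠ j) (l : ℤ) (u : Row Q) :
    (FiniteGate.cnot i j hij l).apply u = cnotEquiv i j hij (D ^ l) u := by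
  simp [FiniteGate.apply, cnotEquiv_apply, timeReversal_D]

lemma FiniteGate.apply_hadamard (i : Q) (u : Row Q) :
    (FiniteGate.hadamard i).apply u = hadamardEquiv i u := rfl

lemma FiniteGate.apply_phase (i : Q) (u : Row Q) :
    (FiniteGate.phase i).apply u = phaseEquiv i 1 u := by
  simp [FiniteGate.apply, phaseEquiv_apply]

lemma FiniteGate.apply_cphaseSelf (i : Q) (l : ℤ) (hl : l ≠ 0) (u : Row Q) :
    (FiniteGate.cphaseSelf i l hl).apply u = phaseEquiv i (D ^ l + D ^ (-l)) u := rfl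

/-- Each additive update is doubled, hence cancelled, in characteristic 2. Reversing a finite-depth
circuit therefore inverts it, so such circuits realize a group. -/
lemma FiniteGate.apply_apply (g : FiniteGate Q) (u : Row Q) : g.apply (g.apply u) = u := by
  cases g with
  | cnot i j hij l =>
    rw [apply_cnot, apply_cnot]
    exact (cnotEquiv i j hij (D ^ l)).left_inv u
  | hadamard i =>
    ext s
    simp [FiniteGate.apply]
  | phase i =>
    rw [apply_phase, apply_phase]
    exact (phaseEquiv i 1).left_inv u
  | cphase i j hij l =>
    ext s
    rcases s with q | q
    · simp only [FiniteGate.apply, Pi.add_apply, ne_eq, reduceCtorEq, not_false_eq_true,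
        Pi.single_eq_of_ne, add_zero]
      have h2 : (2 : K) = 0 := CharTwo.two_eq_zero
      linear_combination ((Pi.single (Sum.inl j) (D ^ l * u (Sum.inr i)) : Row Q) (Sum.inl q) +
        (Pi.single (Sum.inl i) (D ^ (-l) * u (Sum.inr j)) : Row Q) (Sum.inl q)) * h2
    · simp [FiniteGate.apply]
  | cphaseSelf i l hl =>
    rw [apply_cphaseSelf, apply_cphaseSelf]
    exact (phaseEquiv i _).left_inv u

lemma Gate.apply_infinite (i : Q) (f : Laurent) (hf : f ≠ 0) (u : Row Q) :
    (Gate.infinite i f hf).apply u =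
      scaleEquiv i (Laurent.toK f) ((map_ne_zero_iff _ toK_injective).2 hf) u := by
  refine row_ext_at i ?_ ?_ fun q hq => ⟨?_, ?_⟩
  · simp [Gate.apply]
  · simp [Gate.apply]
  · simp [Gate.apply, hq, scaleEquiv_inl_of_ne hq]
  · simp [Gate.apply, hq, scaleEquiv_inr_of_ne hq]

@[simp] lemma runRow_nil (u : Row Q) : runRow [] u = u := rfl

@[simp] lemma runRow_cons (g : Gate Q) (C : List (Gate Q)) (u : Row Q) :
    runRow (g :: C) u = runRow C (g.apply u) := rfl

lemma runRow_append (C C' : List (Gate Q)) (u : Row Q) :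
    runRow (C ++ C') u = runRow C' (runRow C u) := by
  simp [runRow, List.foldl_append]

lemma exists_runRow_finite_inverse (C : List (FiniteGate Q)) :
    ∃ C' : List (FiniteGate Q),
      ∀ u, runRow (C'.map Gate.finite) (runRow (C.map Gate.finite) u) = u := by
  induction C with
  | nil => exact ⟨[], fun u => rfl⟩
  | cons g C ih =>
    obtain ⟨C', h⟩ := ih
    refine ⟨C' ++ [g], fun u => ?_⟩
    rw [List.map_append, runRow_append, List.map_cons (l := C), runRow_cons, h]
    exact g.apply_apply u

/-- A Hadamard exchanges the factors `1/f(D)` and `f(D⁻¹)`, so the infinite-depth gate of `f` is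
undone by that of `f(D⁻¹)` between two Hadamards. -/
lemma exists_runRow_gate_inverse (g : Gate Q) :
    ∃ C : List (Gate Q), ∀ u, runRow C (g.apply u) = u := by
  cases g with
  | finite g => exact ⟨[.finite g], fun u => g.apply_apply u⟩
  | infinite i f hf =>
    refine ⟨[.finite (.hadamard i), .infinite i (LaurentPolynomial.invert f) (by simpa using hf),
      .finite (.hadamard i)], fun u => ?_⟩
    have h0 : Laurent.toK f ≠ 0 := (map_ne_zero_iff _ toK_injective).2 hf
    have h1 := timeReversal_ne_zero h0
    simp only [runRow_cons, runRow_nil, Gate.apply_infinite]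
    refine row_ext_at i ?_ ?_ fun q hq => ⟨?_, ?_⟩
    · simp only [Gate.apply, FiniteGate.apply_hadamard, hadamardEquiv_inl_self,
        scaleEquiv_inr_self, hadamardEquiv_inr_self, scaleEquiv_inl_self, ← timeReversal_toK]
      field_simp
    · simp only [Gate.apply, FiniteGate.apply_hadamard, hadamardEquiv_inl_self,
        scaleEquiv_inr_self, hadamardEquiv_inr_self, scaleEquiv_inl_self, ← timeReversal_toK,
        timeReversal_involutive]
      field_simp
    · simp [Gate.apply, FiniteGate.apply_hadamard, hadamardEquiv_inl_of_ne hq,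
        scaleEquiv_inl_of_ne hq]
    · simp [Gate.apply, FiniteGate.apply_hadamard, hadamardEquiv_inr_of_ne hq,
        scaleEquiv_inr_of_ne hq]

lemma exists_runRow_inverse (C : List (Gate Q)) :
    ∃ C' : List (Gate Q), ∀ u, runRow C' (runRow C u) = u := by
  induction C with
  | nil => exact ⟨[], fun u => rfl⟩
  | cons g C ih =>
    obtain ⟨C', h⟩ := ih
    obtain ⟨C'', h'⟩ := exists_runRow_gate_inverse g
    refine ⟨C' ++ C'', fun u => ?_⟩
    rw [runRow_append, runRow_cons, h, h']

variable (Q) in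
/-- The automorphisms realized by circuits of finite-depth gates. -/
def finiteCircuitSub : Subgroup (RowAut Q) where
  carrier := {g | ∃ C : List (FiniteGate Q), ∀ u, runRow (C.map Gate.finite) u = g u}
  mul_mem' := by
    rintro g h ⟨C, hC⟩ ⟨C', hC'⟩
    refine ⟨C' ++ C, fun u => ?_⟩
    rw [List.map_append, runRow_append, hC', hC, LinearEquiv.mul_apply]
  one_mem' := ⟨[], fun u => rfl⟩
  inv_mem' := by
    rintro g ⟨C, hC⟩
    obtain ⟨C', hC'⟩ := exists_runRow_finite_inverse C
    refine ⟨C', fun u => ?_⟩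
    have h := hC' (g⁻¹ u)
    rw [hC] at h
    rwa [show g (g⁻¹ u) = u from g.apply_symm_apply u] at h

variable (Q) in
/-- The automorphisms realized by circuits. -/
def circuitSub : Subgroup (RowAut Q) where
  carrier := {g | ∃ C : List (Gate Q), ∀ u, runRow C u = g u}
  mul_mem' := by
    rintro g h ⟨C, hC⟩ ⟨C', hC'⟩
    refine ⟨C' ++ C, fun u => ?_⟩
    rw [runRow_append, hC', hC, LinearEquiv.mul_apply]
  one_mem' := ⟨[], fun u => rfl⟩
  inv_mem' := by
    rintro g ⟨C, hC⟩
    obtain ⟨C', hC'⟩ := exists_runRow_inverse C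
    refine ⟨C', fun u => ?_⟩
    have h := hC' (g⁻¹ u)
    rw [hC] at h
    rwa [show g (g⁻¹ u) = u from g.apply_symm_apply u] at h

lemma finiteCircuitSub_le : finiteCircuitSub Q ≤ circuitSub Q :=
  fun _ ⟨C, hC⟩ => ⟨C.map Gate.finite, hC⟩

lemma hadamardEquiv_mem_finiteCircuitSub (i : Q) : hadamardEquiv i ∈ finiteCircuitSub Q :=
  ⟨[.hadamard i], fun _ => rfl⟩

lemma cnotEquiv_zero (i j : Q) (hij : i ≠ j) : cnotEquiv i j hij 0 = 1 := by
  ext1 u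
  simp [cnotEquiv_apply]

lemma cnotEquiv_add (i j : Q) (hij : i ≠ j) (f g : K) :
    cnotEquiv i j hij (f + g) = cnotEquiv i j hij f * cnotEquiv i j hij g := by
  ext1 u
  rw [LinearEquiv.mul_apply]
  have h1 : cnotEquiv i j hij g u (Sum.inr i) = u (Sum.inr i) := by simp [cnotEquiv_apply, hij]
  have h2 : cnotEquiv i j hij g u (Sum.inl j) = u (Sum.inl j) := by
    simp [cnotEquiv_apply, hij.symm]
  rw [cnotEquiv_apply i j hij f (cnotEquiv i j hij g u), h1, h2]
  simp only [cnotEquiv_apply, map_add, add_mul, Pi.single_add]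
  abel

lemma phaseEquiv_zero (i : Q) : phaseEquiv i 0 = 1 := by
  ext1 u
  simp [phaseEquiv_apply]

lemma phaseEquiv_add (i : Q) (f g : K) :
    phaseEquiv i (f + g) = phaseEquiv i f * phaseEquiv i g := by
  ext1 u
  rw [LinearEquiv.mul_apply]
  simp only [phaseEquiv_apply, Pi.add_apply, ne_eq,
    reduceCtorEq, not_false_eq_true, Pi.single_eq_of_ne, add_zero, add_mul, Pi.single_add]
  abel

lemma zmod_two_eq (a : ZMod 2) : a = 0 ∨ a = 1 := by
  revert a; decide

/-- CNOTs with fixed control and target compose by adding multipliers, and over `ZMod 2` a Laurent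
polynomial is a sum of powers of `D`, each of which is one gate. -/
lemma cnotEquiv_mem_finiteCircuitSub (i j : Q) (hij : i ≠ j) {f : K} (hf : f ∈ laurentSubring) :
    cnotEquiv i j hij f ∈ finiteCircuitSub Q := by
  obtain ⟨f, rfl⟩ := mem_laurentSubring.1 hf
  clear hf
  induction f using LaurentPolynomial.induction_on' with
  | add p q hp hq =>
    rw [map_add, cnotEquiv_add]
    exact mul_mem hp hq
  | C_mul_T n a =>
    rcases zmod_two_eq a with rfl | rfl
    · rw [map_zero, zero_mul, map_zero, cnotEquiv_zero]
      exact one_mem _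
    · rw [map_one, one_mul, toK_T]
      exact ⟨[.cnot i j hij n], fun u => FiniteGate.apply_cnot i j hij n u⟩

lemma phaseEquiv_trace_mem_finiteCircuitSub (i : Q) (g : Laurent) :
    phaseEquiv i (Laurent.toK (g + LaurentPolynomial.invert g)) ∈ finiteCircuitSub Q := by
  induction g using LaurentPolynomial.induction_on' with
  | add p q hp hq =>
    rw [map_add LaurentPolynomial.invert, add_add_add_comm, map_add, phaseEquiv_add]
    exact mul_mem hp hq
  | C_mul_T n a =>
    rcases zmod_two_eq a with rfl | rfl
    · simp only [map_zero, zero_mul, add_zero, phaseEquiv_zero]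
      exact one_mem _
    · simp only [map_one, one_mul, LaurentPolynomial.invert_T, map_add, toK_T]
      -- The gate set has no self-controlled phase with delay 0, but its multiplier `1 + 1` would
      -- vanish anyway.
      by_cases hn : n = 0
      · subst hn
        rw [neg_zero, CharTwo.add_self_eq_zero, phaseEquiv_zero]
        exact one_mem _
      · exact ⟨[.cphaseSelf i n hn], fun u => FiniteGate.apply_cphaseSelf i n hn u⟩

/-- An invariant multiplier splits into a constant, given by at most one phase gate, and a trace,
given by self-controlled phases. -/
lemma phaseEquiv_mem_finiteCircuitSub (i : Q) {p : K} (hp : p ∈ laurentSubring)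
    (hs : timeReversal p = p) : phaseEquiv i p ∈ finiteCircuitSub Q := by
  obtain ⟨f, rfl⟩ := mem_laurentSubring.1 hp
  rw [timeReversal_toK] at hs
  obtain ⟨c, g, rfl⟩ := exists_eq_C_add_trace (toK_injective hs)
  rw [map_add, phaseEquiv_add]
  refine mul_mem ?_ (phaseEquiv_trace_mem_finiteCircuitSub i g)
  rcases zmod_two_eq c with rfl | rfl
  · rw [map_zero, map_zero, phaseEquiv_zero]
    exact one_mem _
  · rw [map_one, map_one]
    exact ⟨[.phase i], fun u => FiniteGate.apply_phase i u⟩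

lemma scaleEquiv_mem_circuitSub (i : Q) (f : K) (hf : f ≠ 0) :
    scaleEquiv i f hf ∈ circuitSub Q := by
  have key : ∀ (f : Laurent) (hf : f ≠ 0), scaleEquiv i (Laurent.toK f)
      ((map_ne_zero_iff _ toK_injective).2 hf) ∈ circuitSub Q := fun f hf =>
    ⟨[.infinite i f hf], fun u => Gate.apply_infinite i f hf u⟩
  obtain ⟨a, b, hb, rfl⟩ := exists_toK_div f
  have ha : a ≠ 0 := by
    rintro rfl
    simp at hf
  have hb0 : Laurent.toK b ≠ 0 := (map_ne_zero_iff _ toK_injective).2 hb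
  have hb1 := timeReversal_ne_zero hb0
  have h : scaleEquiv i _ hf = scaleEquiv i _ ((map_ne_zero_iff _ toK_injective).2 ha) *
      (scaleEquiv i _ ((map_ne_zero_iff _ toK_injective).2 hb))⁻¹ := by
    rw [eq_mul_inv_iff_mul_eq]
    ext1 u
    rw [LinearEquiv.mul_apply]
    refine row_ext_at i ?_ ?_ fun q hq => ⟨?_, ?_⟩
    · simp only [scaleEquiv_inl_self, map_div₀]
      field_simp
    · simp only [scaleEquiv_inr_self]
      field_simp
    · simp [scaleEquiv_inl_of_ne hq]
    · simp [scaleEquiv_inr_of_ne hq]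
  rw [h]
  exact mul_mem (key a ha) (inv_mem (key b hb))

/-- Conjugating by a scaling of the target divides the multiplier by the scaling factor, which
introduces the denominator. -/
lemma cnotEquiv_mem_circuitSub (i j : Q) (hij : i ≠ j) (f : K) :
    cnotEquiv i j hij f ∈ circuitSub Q := by
  obtain ⟨a, b, hb, rfl⟩ := exists_toK_div f
  have hb0 : Laurent.toK b ≠ 0 := (map_ne_zero_iff _ toK_injective).2 hb
  have hb1 := timeReversal_ne_zero hb0
  have h : cnotEquiv i j hij (Laurent.toK a / Laurent.toK b) =
      scaleEquiv j _ hb0 * cnotEquiv i j hij (Laurent.toK a) * (scaleEquiv j _ hb0)⁻¹ := by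
    rw [eq_mul_inv_iff_mul_eq]
    ext1 u
    rw [LinearEquiv.mul_apply, LinearEquiv.mul_apply]
    refine row_ext_at j ?_ ?_ fun q hq => ⟨?_, ?_⟩
    · simp [cnotEquiv_apply, hij.symm]
    · simp [cnotEquiv_apply, scaleEquiv_inr_of_ne hij]
      field_simp
    · rw [scaleEquiv_inl_of_ne hq]
      by_cases hqi : q = i
      · subst hqi
        simp [cnotEquiv_apply, scaleEquiv_inl_of_ne hq]
        field_simp
      · simp [cnotEquiv_apply, scaleEquiv_inl_of_ne hq, hqi]
    · rw [scaleEquiv_inr_of_ne hq]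
      simp [cnotEquiv_apply, scaleEquiv_inr_of_ne hq, hq]
  rw [h]
  exact mul_mem (mul_mem (scaleEquiv_mem_circuitSub j _ hb0) (finiteCircuitSub_le
    (cnotEquiv_mem_finiteCircuitSub i j hij (mem_laurentSubring.2 ⟨a, rfl⟩))))
    (inv_mem (scaleEquiv_mem_circuitSub j _ hb0))

/-- Conjugation by the scaling of the denominator `b` replaces `p = a / b` by `p * b(D) * b(D⁻¹) =
a(D) * b(D⁻¹)`, which is Laurent and still invariant. -/
lemma phaseEquiv_mem_circuitSub (i : Q) (p : K) (hp : timeReversal p = p) :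
    phaseEquiv i p ∈ circuitSub Q := by
  obtain ⟨a, b, hb, rfl⟩ := exists_toK_div p
  have hb0 : Laurent.toK b ≠ 0 := (map_ne_zero_iff _ toK_injective).2 hb
  have hb1 := timeReversal_ne_zero hb0
  have h : phaseEquiv i (Laurent.toK a / Laurent.toK b) =
      (scaleEquiv i _ hb0)⁻¹ * (phaseEquiv i (Laurent.toK a * timeReversal (Laurent.toK b)) *
        scaleEquiv i _ hb0) := by
    rw [eq_inv_mul_iff_mul_eq]
    ext1 u
    rw [LinearEquiv.mul_apply, LinearEquiv.mul_apply]
    refine row_ext_at i ?_ ?_ fun q hq => ⟨?_, ?_⟩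
    · simp [phaseEquiv_apply]
      field_simp
    · simp [phaseEquiv_apply]
    · simp [phaseEquiv_apply, scaleEquiv_inl_of_ne hq, hq]
    · simp [phaseEquiv_apply, scaleEquiv_inr_of_ne hq]
  rw [h]
  have ha : Laurent.toK a ∈ laurentSubring := mem_laurentSubring.2 ⟨a, rfl⟩
  have hb' : Laurent.toK b ∈ laurentSubring := mem_laurentSubring.2 ⟨b, rfl⟩
  refine mul_mem (inv_mem (scaleEquiv_mem_circuitSub i _ hb0)) (mul_mem (finiteCircuitSub_le
    (phaseEquiv_mem_finiteCircuitSub i (mul_mem ha (timeReversal_mem hb')) ?_))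
    (scaleEquiv_mem_circuitSub i _ hb0))
  rw [map_div₀] at hp
  rw [map_mul, timeReversal_involutive]
  field_simp at hp
  linear_combination hp

lemma FiniteGate.finiteWeight_apply (g : FiniteGate Q) {u : Row Q}
    (hu : ∀ s, u s ∈ laurentSubring) (s : Q ⊕ Q) : g.apply u s ∈ laurentSubring := by
  have hs : ∀ (t : Q ⊕ Q) {a : K}, a ∈ laurentSubring →
      (Pi.single t a : Row Q) s ∈ laurentSubring := fun t a ha => by
    rw [Pi.single_apply]
    split_ifs
    exacts [ha, zero_mem _]
  have hD := D_zpow_mem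
  cases g with
  | cnot i j hij l =>
    exact add_mem (add_mem (hu s) (hs _ (mul_mem (hD _) (hu _)))) (hs _ (mul_mem (hD _) (hu _)))
  | hadamard i => exact hu _
  | phase i => exact add_mem (hu s) (hs _ (hu _))
  | cphase i j hij l =>
    exact add_mem (add_mem (hu s) (hs _ (mul_mem (hD _) (hu _)))) (hs _ (mul_mem (hD _) (hu _)))
  | cphaseSelf i l hl =>
    exact add_mem (hu s) (hs _ (mul_mem (add_mem (hD _) (hD _)) (hu _)))

lemma runRow_finite_mem (C : List (FiniteGate Q)) {u : Row Q} (hu : ∀ s, u s ∈ laurentSubring) :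
    ∀ s, runRow (C.map Gate.finite) u s ∈ laurentSubring := by
  induction C generalizing u with
  | nil => exact hu
  | cons g C ih => exact ih (g.finiteWeight_apply hu)

lemma isFiniteDepth_map_finite (C : List (FiniteGate Q)) :
    IsFiniteDepth (C.map Gate.finite) := fun _ hu s =>
  mem_laurentSubring.1 (runRow_finite_mem C (fun s => mem_laurentSubring.2 (hu s)) s)

end Circuits

/-! ### Boundedness in time -/

section Online

variable {Q : Type}

lemma Gate.ActsWithin.mono {N N' : ℕ} (h : N ≤ N') {g : Gate Q} (hg : g.ActsWithin N) :
    g.ActsWithin N' := by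
  have h' : (N : ℤ) ≤ N' := by exact_mod_cast h
  match g, hg with
  | .finite (.cnot _ _ _ l), hg => exact lt_of_lt_of_le hg h'
  | .finite (.hadamard _), hg => exact lt_of_lt_of_le hg h
  | .finite (.phase _), hg => exact lt_of_lt_of_le hg h
  | .finite (.cphase _ _ _ l), hg => exact lt_of_lt_of_le hg h'
  | .finite (.cphaseSelf _ l _), hg => exact lt_of_lt_of_le hg h'
  | .infinite _ f _, hg => exact fun p q hp hq => lt_of_lt_of_le (hg p q hp hq) h'

lemma Gate.exists_actsWithin (g : Gate Q) : ∃ N : ℕ, g.ActsWithin N := by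
  have h : ∀ l : ℤ, |l| < (l.natAbs + 1 : ℕ) := fun l => by
    rw [Int.abs_eq_natAbs]; push_cast; omega
  match g with
  | .finite (.cnot _ _ _ l) => exact ⟨_, h l⟩
  | .finite (.hadamard _) => exact ⟨1, Nat.one_pos⟩
  | .finite (.phase _) => exact ⟨1, Nat.one_pos⟩
  | .finite (.cphase _ _ _ l) => exact ⟨_, h l⟩
  | .finite (.cphaseSelf _ l _) => exact ⟨_, h l⟩
  | .infinite _ f _ =>
    -- Two exponents differ by at most twice the largest absolute value; the `+ 1` makes the
    -- inequality strict.
    refine ⟨2 * f.coeff.support.sup Int.natAbs + 1, fun p q hp hq => ?_⟩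
    have h1 : p.natAbs ≤ f.coeff.support.sup Int.natAbs :=
      Finset.le_sup (f := Int.natAbs) (Finsupp.mem_support_iff.2 hp)
    have h2 : q.natAbs ≤ f.coeff.support.sup Int.natAbs :=
      Finset.le_sup (f := Int.natAbs) (Finsupp.mem_support_iff.2 hq)
    push_cast
    omega

/-- Each gate spans finitely many frames and a circuit has finitely many gates. -/
lemma isOnline (C : List (Gate Q)) : IsOnline C := by
  induction C with
  | nil => exact ⟨0, by simp⟩
  | cons g C ih =>
    obtain ⟨N, hN⟩ := ih
    obtain ⟨N', hN'⟩ := g.exists_actsWithin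
    refine ⟨max N N', fun g' hg' => ?_⟩
    rcases List.mem_cons.1 hg' with rfl | h
    · exact hN'.mono (le_max_right _ _)
    · exact (hN g' h).mono (le_max_left _ _)

end Online

/-! ### Moving one isotropic row to a single `Z` -/

section Support

variable {Q : Type} [DecidableEq Q]

/-- The row is trivial outside of `T`. -/
def SupportedOn (T : Finset Q) (u : Row Q) : Prop :=
  ∀ q ∉ T, u (Sum.inl q) = 0 ∧ u (Sum.inr q) = 0

lemma eq_single_add_single {t : Q} {u : Row Q} (hu : SupportedOn {t} u) :
    u = Pi.single (Sum.inl t) (u (Sum.inl t)) + Pi.single (Sum.inr t) (u (Sum.inr t)) := by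
  refine row_ext_at t (by simp) (by simp) fun q hq => ?_
  have := hu q (by simpa using hq)
  simp [this, hq]

lemma exists_entry_ne_zero {T : Finset Q} {u : Row Q} (hu : SupportedOn T u) (h : u ≠ 0) :
    ∃ i ∈ T, u (Sum.inl i) ≠ 0 ∨ u (Sum.inr i) ≠ 0 := by
  by_contra! hc
  apply h
  ext s
  rcases s with q | q
  · by_cases hq : q ∈ T
    · exact (hc q hq).1
    · exact (hu q hq).1
  · by_cases hq : q ∈ T
    · exact (hc q hq).2
    · exact (hu q hq).2

end Support

section Transitivity

variable {Q : Type} [DecidableEq Q] [Fintype Q]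

/-- A group of automorphisms that act on the qubits in `T`, preserve the shifted symplectic product
and the rows over `A`, and comprise the elementary operations with multipliers in `A`. -/
structure IsElementary (A : Subring K) (T : Finset Q) (U : Subgroup (RowAut Q)) : Prop where
  hadamard_mem : ∀ i ∈ T, hadamardEquiv i ∈ U
  cnot_mem : ∀ i ∈ T, ∀ j ∈ T, ∀ hij : i ≠ j, ∀ f ∈ A, cnotEquiv i j hij f ∈ U
  phase_mem : ∀ i ∈ T, ∀ p ∈ A, timeReversal p = p → phaseEquiv i p ∈ U
  le_unitary : U ≤ unitarySub Q
  le_local : U ≤ localSub (T : Set Q)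
  apply_mem : ∀ g ∈ U, ∀ u : Row Q, (∀ s, u s ∈ A) → ∀ s, g u s ∈ A

/-- The automorphisms realized by circuits of finite-depth gates that act on `T` only. -/
def finiteSubOn (T : Finset Q) : Subgroup (RowAut Q) :=
  finiteCircuitSub Q ⊓ unitarySub Q ⊓ localSub (T : Set Q)

/-- The automorphisms realized by circuits that act on `T` only. -/
def circuitSubOn (T : Finset Q) : Subgroup (RowAut Q) :=
  circuitSub Q ⊓ unitarySub Q ⊓ localSub (T : Set Q)

lemma isElementary_finiteSubOn (T : Finset Q) :
    IsElementary laurentSubring T (finiteSubOn T) where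
  hadamard_mem i hi := ⟨⟨hadamardEquiv_mem_finiteCircuitSub i, hadamardEquiv_mem_unitarySub i⟩,
    hadamardEquiv_mem_localSub (Finset.mem_coe.2 hi)⟩
  cnot_mem i hi j hj hij f hf := ⟨⟨cnotEquiv_mem_finiteCircuitSub i j hij hf,
    cnotEquiv_mem_unitarySub i j hij f⟩,
    cnotEquiv_mem_localSub (Finset.mem_coe.2 hi) (Finset.mem_coe.2 hj) hij f⟩
  phase_mem i hi p hp hs := ⟨⟨phaseEquiv_mem_finiteCircuitSub i hp hs,
    phaseEquiv_mem_unitarySub i p hs⟩, phaseEquiv_mem_localSub (Finset.mem_coe.2 hi) p⟩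
  le_unitary := fun _ hg => hg.1.2
  le_local := fun _ hg => hg.2
  apply_mem := by
    rintro g ⟨⟨⟨C, hC⟩, -⟩, -⟩ u hu s
    rw [← hC]
    exact runRow_finite_mem C hu s

lemma isElementary_circuitSubOn (T : Finset Q) : IsElementary ⊤ T (circuitSubOn T) where
  hadamard_mem i hi := ⟨⟨finiteCircuitSub_le (hadamardEquiv_mem_finiteCircuitSub i),
    hadamardEquiv_mem_unitarySub i⟩, hadamardEquiv_mem_localSub (Finset.mem_coe.2 hi)⟩
  cnot_mem i hi j hj hij f _ := ⟨⟨cnotEquiv_mem_circuitSub i j hij f,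
    cnotEquiv_mem_unitarySub i j hij f⟩,
    cnotEquiv_mem_localSub (Finset.mem_coe.2 hi) (Finset.mem_coe.2 hj) hij f⟩
  phase_mem i hi p _ hs := ⟨⟨phaseEquiv_mem_circuitSub i p hs,
    phaseEquiv_mem_unitarySub i p hs⟩, phaseEquiv_mem_localSub (Finset.mem_coe.2 hi) p⟩
  le_unitary := fun _ hg => hg.1.2
  le_local := fun _ hg => hg.2
  apply_mem := fun _ _ _ _ _ => Subring.mem_top _

lemma finiteSubOn_mono {T T' : Finset Q} (h : T ⊆ T') : finiteSubOn T ≤ finiteSubOn T' :=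
  inf_le_inf_left _ (localSub_mono (Finset.coe_subset.2 h))

lemma circuitSubOn_mono {T T' : Finset Q} (h : T ⊆ T') : circuitSubOn T ≤ circuitSubOn T' :=
  inf_le_inf_left _ (localSub_mono (Finset.coe_subset.2 h))

namespace IsElementary

variable {A : Subring K} {T : Finset Q} {U : Subgroup (RowAut Q)}

lemma form_apply (hU : IsElementary A T U)
    {g : RowAut Q} (hg : g ∈ U) (u v : Row Q) : form (g u) (g v) = form u v :=
  hU.le_unitary hg u v

lemma supportedOn_apply (hU : IsElementary A T U)
    {g : RowAut Q} (hg : g ∈ U) {u : Row Q} (hu : SupportedOn T u) :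
    SupportedOn T (g u) := fun q hq => by
  have h := (hU.le_local hg).2 u q (by simpa using hq)
  rw [h.1, h.2]
  exact hu q hq

lemma apply_of_vanishesOn (hU : IsElementary A T U) {g : RowAut Q} (hg : g ∈ U) {u : Row Q}
    (hu : VanishesOn (T : Set Q) u) : g u = u :=
  (hU.le_local hg).1 u hu

/-- The operations that add multiples of the "X" entry at `t` to the entries at `j`. -/
lemma exists_transvection (hU : IsElementary A T U)
    {t j : Q} (ht : t ∈ T) (hj : j ∈ T) (htj : t ≠ j) {f f' : K}
    (hf : f ∈ A) (hf' : f' ∈ A) :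
    ∃ g ∈ U, g (rowZ t) = rowZ t ∧ ∀ w : Row Q,
      g w (Sum.inr t) = w (Sum.inr t) ∧
      g w (Sum.inr j) = w (Sum.inr j) + f * w (Sum.inr t) ∧
      g w (Sum.inl j) = w (Sum.inl j) + f' * w (Sum.inr t) ∧
      ∀ q, q ≠ t → q ≠ j → g w (Sum.inl q) = w (Sum.inl q) ∧ g w (Sum.inr q) = w (Sum.inr q) := by
  have hH := hU.hadamard_mem j hj
  -- The first CNOT writes to the "X" entry of `j`; the second, between Hadamards on `j`, writes to
  -- its "Z" entry. The back-action falls on the "Z" entry of `t`, about which nothing is claimed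
  -- for general `w`.
  refine ⟨hadamardEquiv j * (cnotEquiv t j htj f' * (hadamardEquiv j * cnotEquiv t j htj f)),
    mul_mem hH (mul_mem (hU.cnot_mem t ht j hj htj f' hf')
      (mul_mem hH (hU.cnot_mem t ht j hj htj f hf))), ?_, fun w => ⟨?_, ?_, ?_, ?_⟩⟩
  · simp only [LinearEquiv.mul_apply]
    have h1 : ∀ f, cnotEquiv t j htj f (rowZ t) = rowZ t := fun f => by
      simp [cnotEquiv_apply, rowZ, htj.symm]
    have h2 : hadamardEquiv j (rowZ t) = rowZ t := by
      refine row_ext_at j ?_ ?_ fun q hq => ?_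
      · simp [rowZ, htj.symm]
      · simp [rowZ, htj.symm]
      · exact ⟨hadamardEquiv_inl_of_ne hq _, hadamardEquiv_inr_of_ne hq _⟩
    rw [h1, h2, h1, h2]
  · simp [LinearEquiv.mul_apply, hadamardEquiv_inr_of_ne htj, cnotEquiv_apply, htj]
  · simp [LinearEquiv.mul_apply, cnotEquiv_apply, htj.symm]
  · simp [LinearEquiv.mul_apply, hadamardEquiv_inr_of_ne htj, cnotEquiv_apply, htj, htj.symm]
  · intro q hqt hqj
    simp [LinearEquiv.mul_apply, hadamardEquiv_inr_of_ne hqj, hadamardEquiv_inl_of_ne hqj,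
      cnotEquiv_apply, hqt, hqj]

/-- Entries that are multiples of the "X" entry at `t` can be cleared. -/
lemma exists_clear (hU : IsElementary A T U)
    {t : Q} (ht : t ∈ T) (J : Finset Q) (hJ : J ⊆ T) (htJ : t ∉ J) (w : Row Q)
    (hw : ∀ q ∈ J, (∃ f ∈ A, w (Sum.inl q) = f * w (Sum.inr t)) ∧
      ∃ f ∈ A, w (Sum.inr q) = f * w (Sum.inr t)) :
    ∃ g ∈ U, g (rowZ t) = rowZ t ∧ g w (Sum.inr t) = w (Sum.inr t) ∧
      (∀ q ∈ J, g w (Sum.inl q) = 0 ∧ g w (Sum.inr q) = 0) ∧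
      ∀ q ∉ J, q ≠ t → g w (Sum.inl q) = w (Sum.inl q) ∧ g w (Sum.inr q) = w (Sum.inr q) := by
  induction J using Finset.induction_on with
  | empty => exact ⟨1, one_mem _, rfl, rfl, by simp, fun q _ _ => ⟨rfl, rfl⟩⟩
  | insert j J hj ih =>
    obtain ⟨g, hg, hZ, hx, hv, ho⟩ := ih (fun q hq => hJ (Finset.mem_insert_of_mem hq))
      (fun h => htJ (Finset.mem_insert_of_mem h)) (fun q hq => hw q (Finset.mem_insert_of_mem hq))
    have htj : t ≠ j := fun h => htJ (h ▸ Finset.mem_insert_self _ _)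
    obtain ⟨⟨f', hf', hz'⟩, ⟨f, hf, hx'⟩⟩ := hw j (Finset.mem_insert_self _ _)
    obtain ⟨g', hg', hZ', h'⟩ := hU.exists_transvection ht (hJ (Finset.mem_insert_self _ _)) htj
      hf hf'
    obtain ⟨h1, h2, h3, h4⟩ := h' (g w)
    refine ⟨g' * g, mul_mem hg' hg, ?_, ?_, fun q hq => ?_, fun q hq hqt => ?_⟩
    · rw [LinearEquiv.mul_apply, hZ, hZ']
    · rw [LinearEquiv.mul_apply, h1, hx]
    · rw [LinearEquiv.mul_apply]
      rcases Finset.mem_insert.1 hq with rfl | hq'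
      · rw [h2, h3, hx, (ho q hj htj.symm).1, (ho q hj htj.symm).2, hz', hx']
        simp [CharTwo.add_self_eq_zero]
      · have hqt : q ≠ t := fun h => htJ (h ▸ hq)
        have hqj : q ≠ j := fun h => hj (h ▸ hq')
        rw [(h4 q hqt hqj).1, (h4 q hqt hqj).2]
        exact hv q hq'
    · have hqj : q ≠ j := fun h => hq (h ▸ Finset.mem_insert_self _ _)
      have hqJ : q ∉ J := fun h => hq (Finset.mem_insert_of_mem h)
      rw [LinearEquiv.mul_apply, (h4 q hqt hqj).1, (h4 q hqt hqj).2]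
      exact ho q hqJ hqt

/-- An isotropic row with "X" entry `1` at `t` can be mapped to `X` on `t`, with `Z` on `t`
fixed. -/
lemma exists_apply_eq_rowX (hU : IsElementary A T U)
    {t : Q} (ht : t ∈ T) {u : Row Q} (hu : SupportedOn T u)
    (hA : ∀ s, u s ∈ A) (h1 : u (Sum.inr t) = 1) (h0 : form u u = 0) :
    ∃ g ∈ U, g u = rowX t ∧ g (rowZ t) = rowZ t := by
  obtain ⟨g, hg, hZ, hx, hv, -⟩ := hU.exists_clear ht (T.erase t) (Finset.erase_subset _ _)
    (Finset.notMem_erase _ _) u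
    (fun q _ => ⟨⟨u (Sum.inl q), hA _, by simp [h1]⟩, ⟨u (Sum.inr q), hA _, by simp [h1]⟩⟩)
  set z := g u (Sum.inl t) with hz
  have hs : SupportedOn {t} (g u) := fun q hq => by
    have hqt : q ≠ t := by simpa using hq
    by_cases hqT : q ∈ T
    · exact hv q (Finset.mem_erase.2 ⟨hqt, hqT⟩)
    · exact hU.supportedOn_apply hg hu q hqT
  have he := eq_single_add_single hs
  rw [hx, h1, ← hz] at he
  -- The row is now `X + z Z` on `t`, whose product with itself is `z + timeReversal z`. Isotropy
  -- thus makes `z` an admissible phase multiplier.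
  have hzs : timeReversal z = z := by
    have h := hU.form_apply hg u u
    rw [h0, he] at h
    simp only [form_add_left, form_add_right, form_single_inl_left, form_single_inr_left] at h
    simpa [CharTwo.add_eq_zero] using h
  have hzA : z ∈ A := hU.apply_mem g hg u hA _
  refine ⟨phaseEquiv t z * g, mul_mem (hU.phase_mem t ht z hzA hzs) hg, ?_, ?_⟩
  · rw [LinearEquiv.mul_apply, he, phaseEquiv_apply]
    refine row_ext_at t ?_ ?_ fun q hq => ?_
    · simp [rowX, CharTwo.add_self_eq_zero]
    · simp [rowX]
    · simp [rowX, hq]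
  · rw [LinearEquiv.mul_apply, hZ]
    simp [phaseEquiv_apply, rowZ]

/-- An entry 1 serves as a pivot: a Hadamard makes it an "X" entry, a CNOT produces an "X" entry 1
at `t`, and the row is then cleared to `X` on `t` and turned into `Z`. -/
lemma exists_apply_eq_rowZ_of_entry (hU : IsElementary A T U)
    {t : Q} (ht : t ∈ T) {u : Row Q} (hu : SupportedOn T u)
    (hA : ∀ s, u s ∈ A) (h0 : form u u = 0) {i : Q} (hi : i ∈ T)
    (h1 : u (Sum.inl i) = 1 ∨ u (Sum.inr i) = 1) :
    ∃ g ∈ U, g u = rowZ t := by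
  obtain ⟨g, hg, hgu⟩ : ∃ g ∈ U, g u (Sum.inr i) = 1 := by
    rcases h1 with h1 | h1
    · exact ⟨hadamardEquiv i, hU.hadamard_mem i hi, by simpa using h1⟩
    · exact ⟨1, one_mem _, h1⟩
  obtain ⟨g', hg', hgu'⟩ : ∃ g' ∈ U, g' u (Sum.inr t) = 1 := by
    by_cases hit : i = t
    · subst hit; exact ⟨g, hg, hgu⟩
    -- The multiplier cancels the old entry at `t` and replaces it by 1.
    · refine ⟨cnotEquiv i t hit (g u (Sum.inr t) + 1) * g, mul_mem (hU.cnot_mem i hi t ht hit _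
        (add_mem (hU.apply_mem g hg u hA _) (one_mem _))) hg, ?_⟩
      simp [LinearEquiv.mul_apply, cnotEquiv_apply, hgu, ← add_assoc, CharTwo.add_self_eq_zero]
  obtain ⟨g'', hg'', h, -⟩ := hU.exists_apply_eq_rowX ht (hU.supportedOn_apply hg' hu)
    (hU.apply_mem g' hg' u hA) hgu' (by rw [hU.form_apply hg', h0])
  refine ⟨hadamardEquiv t * (g'' * g'), mul_mem (hU.hadamard_mem t ht) (mul_mem hg'' hg'), ?_⟩
  rw [LinearEquiv.mul_apply, LinearEquiv.mul_apply, h]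
  refine row_ext_at t ?_ ?_ fun q hq => ?_
  · simp [rowX, rowZ]
  · simp [rowX, rowZ]
  · simp [hadamardEquiv_inl_of_ne hq, hadamardEquiv_inr_of_ne hq, rowX, rowZ, hq]

end IsElementary

/-- With infinite-depth gates any nonzero entry can be scaled to a pivot 1, so neither a spare qubit
nor a scalar factor is needed. -/
lemma exists_circuit_apply_eq_rowZ {T : Finset Q} {t : Q} (ht : t ∈ T) {u : Row Q}
    (hu : SupportedOn T u) (h : u ≠ 0) (h0 : form u u = 0) :
    ∃ g ∈ circuitSubOn T, g u = rowZ t := by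
  have hU := isElementary_circuitSubOn T
  obtain ⟨i, hi, hne⟩ := exists_entry_ne_zero hu h
  have hS : ∀ (f : K) (hf : f ≠ 0), scaleEquiv i f hf ∈ circuitSubOn T := fun f hf =>
    ⟨⟨scaleEquiv_mem_circuitSub i f hf, scaleEquiv_mem_unitarySub i f hf⟩,
      scaleEquiv_mem_localSub (Finset.mem_coe.2 hi) f hf⟩
  obtain ⟨g, hg, h1⟩ : ∃ g ∈ circuitSubOn T, g u (Sum.inl i) = 1 ∨ g u (Sum.inr i) = 1 := by
    rcases hne with hne | hne
    · refine ⟨_, hS (timeReversal (u (Sum.inl i)))⁻¹ (inv_ne_zero (timeReversal_ne_zero hne)),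
        Or.inl ?_⟩
      simp [timeReversal_involutive, hne]
    · refine ⟨_, hS (u (Sum.inr i)) hne, Or.inr ?_⟩
      simp [hne]
  obtain ⟨g', hg', h'⟩ := hU.exists_apply_eq_rowZ_of_entry ht (hU.supportedOn_apply hg hu)
    (fun _ => Subring.mem_top _) (by rw [hU.form_apply hg, h0]) hi h1
  exact ⟨g' * g, mul_mem hg' hg, h'⟩

lemma exists_finite_apply_eq_smul_rowZ {T : Finset Q} {t : Q} (ht : t ∈ T) (hT : 1 < T.card)
    {u : Row Q} (hu : SupportedOn T u) (h : u ≠ 0) (h0 : form u u = 0) :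
    ∃ g ∈ finiteSubOn T, ∃ a : K, g u = a • rowZ t := by
  classical
  have hU := isElementary_finiteSubOn T
  set U := finiteSubOn T
  obtain ⟨d, hd, hdu⟩ := exists_common_denominator u
  set v : Row Q := d • u with hv
  have hvA : ∀ s, v s ∈ laurentSubring := hdu
  have hvT : SupportedOn T v := fun q hq => by simp [hv, hu q hq]
  have hv0 : v ≠ 0 := smul_ne_zero hd h
  -- The minimum is taken over the nonzero entries of all images of `v` under `U` at once.
  have hex : ∃ N : ℕ, ∃ g ∈ U, ∃ s, g v s ≠ 0 ∧ size (g v s) = N := by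
    obtain ⟨s, hs⟩ := Function.ne_iff.1 hv0
    exact ⟨_, 1, one_mem _, s, hs, rfl⟩
  obtain ⟨g, hg, i, hi, hb0, hbN⟩ : ∃ g ∈ U, ∃ i ∈ T, g v (Sum.inr i) ≠ 0 ∧
      size (g v (Sum.inr i)) = Nat.find hex := by
    obtain ⟨g, hg, s, hs0, hs⟩ := Nat.find_spec hex
    rcases s with i | i
    · have hi : i ∈ T := by
        by_contra hi
        exact hs0 (hU.supportedOn_apply hg hvT i hi).1
      refine ⟨hadamardEquiv i * g, mul_mem (hU.hadamard_mem i hi) hg, i, hi, ?_⟩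
      simp only [LinearEquiv.mul_apply, hadamardEquiv_inr_self]
      exact ⟨hs0, hs⟩
    · have hi : i ∈ T := by
        by_contra hi
        exact hs0 (hU.supportedOn_apply hg hvT i hi).2
      exact ⟨g, hg, i, hi, hs0, hs⟩
  have hmin : ∀ g' ∈ U, ∀ s, ¬ size (g' v s) < Nat.find hex ∨ g' v s = 0 := by
    intro g' hg' s
    by_contra! hc
    exact Nat.find_min hex hc.1 ⟨g', hg', s, hc.2, rfl⟩
  have hgA := hU.apply_mem g hg v hvA
  set b := g v (Sum.inr i) with hb
  have hdiv : ∀ q ∈ T.erase i, (∃ f ∈ laurentSubring, g v (Sum.inl q) = f * b) ∧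
      ∃ f ∈ laurentSubring, g v (Sum.inr q) = f * b := by
    intro q hq
    obtain ⟨hqi, hqT⟩ := Finset.mem_erase.1 hq
    constructor
    · obtain ⟨f, hf, hlt⟩ := exists_add_mul_size_lt (hgA (Sum.inl q)) (hgA (Sum.inr i)) hb0
      refine ⟨f, hf, ?_⟩
      obtain ⟨g', hg', -, h'⟩ := hU.exists_transvection hi hqT hqi.symm (zero_mem _) hf
      have h3 := (h' (g v)).2.2.1
      have h4 := hmin (g' * g) (mul_mem hg' hg) (Sum.inl q)
      rw [LinearEquiv.mul_apply, h3, ← hbN] at h4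
      rw [← CharTwo.add_eq_zero]
      tauto
    · obtain ⟨f, hf, hlt⟩ := exists_add_mul_size_lt (hgA (Sum.inr q)) (hgA (Sum.inr i)) hb0
      refine ⟨f, hf, ?_⟩
      obtain ⟨g', hg', -, h'⟩ := hU.exists_transvection hi hqT hqi.symm hf (zero_mem _)
      have h3 := (h' (g v)).2.1
      have h4 := hmin (g' * g) (mul_mem hg' hg) (Sum.inr q)
      rw [LinearEquiv.mul_apply, h3, ← hbN] at h4
      rw [← CharTwo.add_eq_zero]
      tauto
  obtain ⟨g', hg', -, hx, hvan, -⟩ := hU.exists_clear hi (T.erase i) (Finset.erase_subset _ _)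
    (Finset.notMem_erase _ _) (g v) hdiv
  rw [← hb] at hx
  set w := g' (g v) with hw
  have hwT : SupportedOn {i} w := fun q hq => by
    have hqi : q ≠ i := by simpa using hq
    by_cases hqT : q ∈ T
    · exact hvan q (Finset.mem_erase.2 ⟨hqi, hqT⟩)
    · exact hU.supportedOn_apply hg' (hU.supportedOn_apply hg hvT) q hqT
  have hwA := hU.apply_mem g' hg' _ hgA
  obtain ⟨j, hj, hji⟩ := Finset.exists_mem_ne hT i
  obtain ⟨f, hf, hfz⟩ : ∃ f ∈ laurentSubring, w (Sum.inl i) = f * b := by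
    obtain ⟨f, hf, hlt⟩ := exists_add_mul_size_lt (hwA (Sum.inl i)) (hgA (Sum.inr i)) hb0
    refine ⟨f, hf, ?_⟩
    have hH := hU.hadamard_mem i hi
    -- The "Z" entry at `i` is copied into the empty "X" entry at the spare qubit `j` (a CNOT
    -- between Hadamards on `i`); then `f` times the pivot is added, so the remainder appears as an
    -- entry of the orbit.
    have h4 := hmin (cnotEquiv i j hji.symm f * (hadamardEquiv i * (cnotEquiv i j hji.symm 1 *
      (hadamardEquiv i * (g' * g)))))
      (mul_mem (hU.cnot_mem i hi j hj _ f hf) (mul_mem hH (mul_mem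
        (hU.cnot_mem i hi j hj _ 1 (one_mem _)) (mul_mem hH (mul_mem hg' hg))))) (Sum.inr j)
    have h5 : (cnotEquiv i j hji.symm f * (hadamardEquiv i * (cnotEquiv i j hji.symm 1 *
      (hadamardEquiv i * (g' * g))))) v (Sum.inr j) = w (Sum.inl i) + f * b := by
      have hwj := hvan j (Finset.mem_erase.2 ⟨hji, hj⟩)
      simp only [LinearEquiv.mul_apply, ← hw]
      simp [cnotEquiv_apply, hadamardEquiv_inr_of_ne hji, hadamardEquiv_inl_of_ne hji, hwj, hx]
    rw [h5, ← hbN] at h4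
    rw [← CharTwo.add_eq_zero]
    tauto
  have hbw : SupportedOn {i} (b⁻¹ • w) := fun q hq => by simp [hwT q hq]
  have hbT : SupportedOn T (b⁻¹ • w) := fun q hq =>
    hbw q (by rintro h; exact hq (Finset.mem_singleton.1 h ▸ hi))
  have hbx : (b⁻¹ • w) (Sum.inr i) = 1 := by simp [hx, hb0]
  have hbz : (b⁻¹ • w) (Sum.inl i) = f := by simp [hfz]; field_simp
  obtain ⟨g'', hg'', hfin⟩ := hU.exists_apply_eq_rowZ_of_entry ht (u := b⁻¹ • w) hbT (by
      intro s
      rcases s with q | q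
      · by_cases hq : q = i
        · subst hq; rw [hbz]; exact hf
        · rw [(hbw q (by simpa using hq)).1]; exact zero_mem _
      · by_cases hq : q = i
        · subst hq; rw [hbx]; exact one_mem _
        · rw [(hbw q (by simpa using hq)).2]; exact zero_mem _)
    (by rw [form_smul_left, form_smul_right, hw, hU.form_apply hg', hU.form_apply hg, hv,
          form_smul_left, form_smul_right, h0]; simp) hi (Or.inr hbx)
  refine ⟨g'' * (g' * g), mul_mem hg'' (mul_mem hg' hg), d⁻¹ * b, ?_⟩
  have hwu : b⁻¹ • w = (b⁻¹ * d) • g' (g u) := by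
    rw [hw, hv, map_smul, map_smul, smul_smul]
  rw [hwu, map_smul] at hfin
  rw [LinearEquiv.mul_apply, LinearEquiv.mul_apply, ← hfin, smul_smul]
  rw [show d⁻¹ * b * (b⁻¹ * d) = 1 by field_simp, one_smul]

end Transitivity

/-! ### Isotropic spaces and symplectic pairs -/

section Isotropic

variable {Q : Type} [DecidableEq Q] [Fintype Q]

lemma form_rowZ_left (t : Q) (v : Row Q) : form (rowZ t) v = timeReversal (v (Sum.inr t)) := by
  simp [rowZ, form_single_inl_left]

lemma form_rowX_left (t : Q) (v : Row Q) : form (rowX t) v = timeReversal (v (Sum.inl t)) := by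
  simp [rowX, form_single_inr_left]

lemma eq_zero_of_form_rowZ {t : Q} {v : Row Q} (h : form (rowZ t) v = 0) : v (Sum.inr t) = 0 := by
  rwa [form_rowZ_left, _root_.map_eq_zero] at h

lemma eq_zero_of_form_rowX {t : Q} {v : Row Q} (h : form (rowX t) v = 0) : v (Sum.inl t) = 0 := by
  rwa [form_rowX_left, _root_.map_eq_zero] at h

/-- If the groups `U T` act transitively on isotropic lines, an isotropic space of rows can be
mapped into the span of the `Z` operators on as many qubits as its dimension. -/
lemma exists_map_isotropic {A : Subring K} {κ : ℕ} {U : Finset Q → Subgroup (RowAut Q)}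
    (hU : ∀ T, IsElementary A T (U T)) (hmono : ∀ T T', T ⊆ T' → U T ≤ U T')
    (htrans : ∀ (T : Finset Q) (t : Q) (u : Row Q), t ∈ T → κ < T.card → SupportedOn T u → u ≠ 0 →
      form u u = 0 → ∃ g ∈ U T, ∃ a : K, g u = a • rowZ t)
    (T₀ T : Finset Q) (hT : T₀ ⊆ T) (hcard : T₀.card + κ ≤ T.card) (S : Submodule K (Row Q))
    (hS : ∀ u ∈ S, SupportedOn T u) (hiso : ∀ u ∈ S, ∀ v ∈ S, form u v = 0)
    (hdim : Module.finrank K S ≤ T₀.card) :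
    ∃ g ∈ U T, ∀ u ∈ S, (∀ q, g u (Sum.inr q) = 0) ∧ ∀ q ∉ T₀, g u (Sum.inl q) = 0 := by
  have hbot : S = ⊥ → ∃ g ∈ U T, ∀ u ∈ S, (∀ q, g u (Sum.inr q) = 0) ∧
      ∀ q ∉ T₀, g u (Sum.inl q) = 0 := by
    rintro rfl
    refine ⟨1, one_mem _, fun u hu => ?_⟩
    rw [(Submodule.mem_bot K).1 hu]
    simp
  induction T₀ using Finset.induction_on generalizing T S with
  | empty => exact hbot (Submodule.finrank_eq_zero.1 (by simpa using hdim))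
  | insert t T₀ ht ih =>
    by_cases hS0 : S = ⊥
    · exact hbot hS0
    obtain ⟨s, hs, hs0⟩ := (Submodule.ne_bot_iff S).1 hS0
    have htT : t ∈ T := hT (Finset.mem_insert_self _ _)
    rw [Finset.card_insert_of_notMem ht] at hcard hdim
    obtain ⟨g, hg, a, hga⟩ := htrans T t s htT (by omega) (hS s hs) hs0 (hiso s hs s hs)
    have ha : a ≠ 0 := by
      rintro rfl
      rw [zero_smul] at hga
      exact hs0 (g.map_eq_zero_iff.1 hga)
    set S₁ := S.map (g : Row Q →ₗ[K] Row Q) with hS₁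
    have hZ : rowZ t ∈ S₁ := by
      have : a⁻¹ • g s ∈ S₁ := Submodule.smul_mem _ _ ⟨s, hs, rfl⟩
      rwa [hga, smul_smul, inv_mul_cancel₀ ha, one_smul] at this
    have hiso₁ : ∀ u ∈ S₁, ∀ v ∈ S₁, form u v = 0 := by
      rintro _ ⟨u, hu, rfl⟩ _ ⟨v, hv, rfl⟩
      exact ((hU T).form_apply hg u v).trans (hiso u hu v hv)
    have hsupp₁ : ∀ u ∈ S₁, SupportedOn T u := by
      rintro _ ⟨u, hu, rfl⟩
      exact (hU T).supportedOn_apply hg (hS u hu)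
    have hx₁ : ∀ u ∈ S₁, u (Sum.inr t) = 0 := fun u hu => eq_zero_of_form_rowZ (hiso₁ _ hZ u hu)
    -- Orthogonality to `rowZ t` has removed the "X" entries at `t`; requiring a zero "Z" entry as
    -- well gives a complement of the line of `rowZ t`, trivial on `t`. The induction runs on it
    -- inside `T.erase t`, where operations fix `rowZ t`.
    set S₂ := S₁ ⊓ LinearMap.ker (LinearMap.proj (R := K) (φ := fun _ => K) (Sum.inl t)) with hS₂
    have hlt : S₂ < S₁ := by
      refine lt_of_le_of_ne inf_le_left fun h => ?_
      have h1 : rowZ t ∈ S₂ := h ▸ hZ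
      have h2 : rowZ t (Sum.inl t) = 0 := h1.2
      simp [rowZ] at h2
    have hfin : Module.finrank K S₂ < Module.finrank K S := by
      have h1 := Submodule.finrank_lt_finrank_of_lt hlt
      have h2 : Module.finrank K S₁ = Module.finrank K S := LinearEquiv.finrank_map_eq g S
      omega
    have hcardT := Finset.card_erase_of_mem htT
    have hsupp₂ : ∀ u ∈ S₂, SupportedOn (T.erase t) u := fun u hu q hq => by
      by_cases hqt : q = t
      · subst hqt
        exact ⟨hu.2, hx₁ u hu.1⟩
      · exact hsupp₁ u hu.1 q fun h => hq (Finset.mem_erase.2 ⟨hqt, h⟩)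
    obtain ⟨g', hg', h'⟩ := ih (T.erase t)
      (fun q hq => Finset.mem_erase.2 ⟨fun h => ht (h ▸ hq), hT (Finset.mem_insert_of_mem hq)⟩)
      (by omega) S₂ hsupp₂ (fun u hu v hv => hiso₁ u hu.1 v hv.1) (by omega) (by
        intro h0
        refine ⟨1, one_mem _, fun u hu => ?_⟩
        rw [h0, Submodule.mem_bot] at hu
        simp [hu])
    have hg'Z : g' (rowZ t) = rowZ t := (hU _).apply_of_vanishesOn hg' fun q hq => by
      have hqt : q ≠ t := (Finset.mem_erase.1 (Finset.mem_coe.1 hq)).1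
      simp [rowZ, hqt]
    refine ⟨g' * g, mul_mem (hmono _ _ (Finset.erase_subset _ _) hg') hg, fun u hu => ?_⟩
    rw [LinearEquiv.mul_apply]
    have hgu : g u ∈ S₁ := ⟨u, hu, rfl⟩
    set w := g u + g u (Sum.inl t) • rowZ t with hw
    have hw₂ : w ∈ S₂ := by
      refine ⟨add_mem hgu (Submodule.smul_mem _ _ hZ), ?_⟩
      simp [hw, rowZ, CharTwo.add_self_eq_zero]
    have hgw : g' (g u) = g' w + g u (Sum.inl t) • rowZ t := by
      rw [hw, map_add, map_smul, hg'Z, add_assoc, row_add_self, add_zero]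
    obtain ⟨h1, h2⟩ := h' w hw₂
    rw [hgw]
    refine ⟨fun q => ?_, fun q hq => ?_⟩
    · simp [h1 q, rowZ]
    · have hqt : q ≠ t := fun h => hq (h ▸ Finset.mem_insert_self _ _)
      simp [h2 q fun h => hq (Finset.mem_insert_of_mem h), rowZ, hqt]

/-- Here `κ = 1`: a qubit outside `T₀` is never used up by the induction and is the spare one that
Euclidean descent requires. -/
lemma exists_finite_map_isotropic (T₀ : Finset Q) (hT : T₀ ≠ Finset.univ)
    (S : Submodule K (Row Q)) (hiso : ∀ u ∈ S, ∀ v ∈ S, form u v = 0)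
    (hdim : Module.finrank K S ≤ T₀.card) :
    ∃ g ∈ finiteSubOn (Finset.univ : Finset Q),
      ∀ u ∈ S, (∀ q, g u (Sum.inr q) = 0) ∧ ∀ q ∉ T₀, g u (Sum.inl q) = 0 :=
  exists_map_isotropic (κ := 1) isElementary_finiteSubOn (fun _ _ => finiteSubOn_mono)
    (fun _ _ _ ht hT hu h h0 => exists_finite_apply_eq_smul_rowZ ht hT hu h h0) T₀ Finset.univ
    (Finset.subset_univ _) (Finset.card_lt_card (Finset.ssubset_univ_iff.2 hT)) S
    (fun _ _ q hq => absurd (Finset.mem_univ q) hq) hiso hdim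

/-- Here `κ = 0`: all qubits of `T` may be used up. -/
lemma exists_circuit_map_isotropic (T : Finset Q) (S : Submodule K (Row Q))
    (hS : ∀ u ∈ S, SupportedOn T u) (hiso : ∀ u ∈ S, ∀ v ∈ S, form u v = 0)
    (hdim : Module.finrank K S ≤ T.card) :
    ∃ g ∈ circuitSubOn T, ∀ u ∈ S, (∀ q, g u (Sum.inr q) = 0) ∧ ∀ q ∉ T, g u (Sum.inl q) = 0 :=
  exists_map_isotropic (κ := 0) isElementary_circuitSubOn (fun _ _ => circuitSubOn_mono)
    (fun _ t _ ht _ hu h h0 => by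
      obtain ⟨g, hg, hgu⟩ := exists_circuit_apply_eq_rowZ ht hu h h0
      exact ⟨g, hg, 1, by rw [hgu, one_smul]⟩) T T le_rfl le_rfl S hS hiso hdim

/-- Families of symplectic pairs can be mapped to the standard pairs. -/
lemma exists_circuit_map_pairs (P T : Finset Q) (hPT : P ⊆ T) (u v : Q → Row Q)
    (hu : ∀ i ∈ P, SupportedOn T (u i)) (hv : ∀ i ∈ P, SupportedOn T (v i))
    (huu : ∀ i ∈ P, ∀ j ∈ P, form (u i) (u j) = 0) (hvv : ∀ i ∈ P, ∀ j ∈ P, form (v i) (v j) = 0)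
    (huv : ∀ i ∈ P, ∀ j ∈ P, form (u i) (v j) = if i = j then 1 else 0) :
    ∃ g ∈ circuitSubOn T, ∀ i ∈ P, g (u i) = rowZ i ∧ g (v i) = rowX i := by
  induction P using Finset.induction_on generalizing T u v with
  | empty => exact ⟨1, one_mem _, by simp⟩
  | insert i P hi ih =>
    have hU := isElementary_circuitSubOn T
    have hiP := Finset.mem_insert_self i P
    have hmem : ∀ {j}, j ∈ P → j ∈ insert i P := fun h => Finset.mem_insert_of_mem h
    have hiT : i ∈ T := hPT hiP
    have hui : u i ≠ 0 := fun h => by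
      have := huv i hiP i hiP
      simp [h, form] at this
    obtain ⟨g₁, hg₁, h₁⟩ := exists_circuit_apply_eq_rowZ hiT (hu i hiP) hui (huu i hiP i hiP)
    have hx : g₁ (v i) (Sum.inr i) = 1 := by
      have h := huv i hiP i hiP
      rw [← hU.form_apply hg₁, h₁, form_rowZ_left, if_pos rfl] at h
      rw [← timeReversal_involutive (g₁ (v i) (Sum.inr i)), h, map_one]
    obtain ⟨g₂, hg₂, h₂, h₂'⟩ := hU.exists_apply_eq_rowX hiT
      (hU.supportedOn_apply hg₁ (hv i hiP)) (fun _ => Subring.mem_top _) hx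
      (by rw [hU.form_apply hg₁, hvv i hiP i hiP])
    have hg := mul_mem hg₂ hg₁
    set g := g₂ * g₁ with hgdef
    have hgu : g (u i) = rowZ i := by rw [hgdef, LinearEquiv.mul_apply, h₁, h₂']
    have hgv : g (v i) = rowX i := by rw [hgdef, LinearEquiv.mul_apply, h₂]
    clear_value g
    -- Orthogonality to the pair at `i` makes the image trivial on qubit `i`, so the other pairs
    -- live on `T.erase i`, and operations there keep the pair at `i` fixed.
    have hsupp : ∀ w, SupportedOn T w → form (u i) w = 0 → form (v i) w = 0 →
        SupportedOn (T.erase i) (g w) := fun w hw hz hx q hq => by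
      by_cases hqi : q = i
      · subst hqi
        rw [← hU.form_apply hg, hgu] at hz
        rw [← hU.form_apply hg, hgv] at hx
        exact ⟨eq_zero_of_form_rowX hx, eq_zero_of_form_rowZ hz⟩
      · exact hU.supportedOn_apply hg hw q fun h => hq (Finset.mem_erase.2 ⟨hqi, h⟩)
    have hne : ∀ j ∈ P, i ≠ j := fun j hj h => hi (h ▸ hj)
    obtain ⟨g₃, hg₃, h₃⟩ := ih (T.erase i)
      (fun q hq => Finset.mem_erase.2 ⟨(hne q hq).symm, hPT (hmem hq)⟩)
      (fun j => g (u j)) (fun j => g (v j))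
      (fun j hj => hsupp _ (hu j (hmem hj)) (huu i hiP j (hmem hj)) (by
        rw [← timeReversal_form, huv j (hmem hj) i hiP, if_neg (hne j hj).symm, map_zero]))
      (fun j hj => hsupp _ (hv j (hmem hj)) (by rw [huv i hiP j (hmem hj), if_neg (hne j hj)])
        (hvv i hiP j (hmem hj)))
      (fun j hj l hl => by rw [hU.form_apply hg, huu j (hmem hj) l (hmem hl)])
      (fun j hj l hl => by rw [hU.form_apply hg, hvv j (hmem hj) l (hmem hl)])
      (fun j hj l hl => by rw [hU.form_apply hg, huv j (hmem hj) l (hmem hl)])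
    refine ⟨g₃ * g, mul_mem (circuitSubOn_mono (Finset.erase_subset _ _) hg₃) hg,
      fun j hj => ?_⟩
    rw [LinearEquiv.mul_apply, LinearEquiv.mul_apply]
    rcases Finset.mem_insert.1 hj with rfl | hj
    · rw [hgu, hgv]
      constructor
      · refine (isElementary_circuitSubOn _).apply_of_vanishesOn hg₃ fun q hq => ?_
        have hqj : q ≠ j := (Finset.mem_erase.1 (Finset.mem_coe.1 hq)).1
        simp [rowZ, hqj]
      · refine (isElementary_circuitSubOn _).apply_of_vanishesOn hg₃ fun q hq => ?_
        have hqj : q ≠ j := (Finset.mem_erase.1 (Finset.mem_coe.1 hq)).1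
        simp [rowX, hqj]
    · exact h₃ j hj

end Isotropic

/-! ### Spans and the dimension bound for isotropic families -/

section Span

variable {Q : Type}

lemma supportedOn_of_mem_span {ι : Type} {M : ι → Row Q} {T : Finset Q}
    (h : ∀ r, SupportedOn T (M r)) {u : Row Q} (hu : u ∈ Submodule.span K (Set.range M)) :
    SupportedOn T u := by
  induction hu using Submodule.span_induction with
  | mem x hx =>
    obtain ⟨r, rfl⟩ := hx
    exact h r
  | zero => exact fun q _ => ⟨rfl, rfl⟩
  | add x y _ _ h1 h2 => exact fun q hq => by simp [h1 q hq, h2 q hq]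
  | smul a x _ h1 => exact fun q hq => by simp [h1 q hq]

variable [Fintype Q]

lemma form_sum_right {ι : Type} [Fintype ι] (u : Row Q) (v : ι → Row Q) (c : ι → K)
    (h : ∀ i, form u (v i) = 0) : form u (∑ i, c i • v i) = 0 := by
  have : ∀ s : Finset ι, form u (∑ i ∈ s, c i • v i) = 0 := fun s => by
    induction s using Finset.cons_induction with
    | empty => simp [form]
    | cons i s hi ih => rw [Finset.sum_cons, form_add_right, ih, form_smul_right, h]; simp
  exact this _

lemma form_comm_eq_zero {u v : Row Q} (h : form u v = 0) : form v u = 0 := by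
  rw [← timeReversal_form, h, map_zero]

lemma form_eq_zero_of_mem_span {ι : Type} {M : ι → Row Q} (h : ∀ r r', form (M r) (M r') = 0)
    {u v : Row Q} (hu : u ∈ Submodule.span K (Set.range M))
    (hv : v ∈ Submodule.span K (Set.range M)) : form u v = 0 := by
  induction hu, hv using Submodule.span_induction₂ with
  | mem_mem x y hx hy =>
    obtain ⟨r, rfl⟩ := hx
    obtain ⟨r', rfl⟩ := hy
    exact h r r'
  | zero_left y hy => simp [form]
  | zero_right x hx => simp [form]
  | add_left x y z _ _ _ h1 h2 => rw [form_add_left, h1, h2, add_zero]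
  | add_right x y z _ _ _ h1 h2 => rw [form_add_right, h1, h2, add_zero]
  | smul_left a x y _ _ h1 => rw [form_smul_left, h1, mul_zero]
  | smul_right a x y _ _ h1 => rw [form_smul_right, h1, mul_zero]

/-- Linearly independent, mutually orthogonal rows are at most as many as the qubits. -/
lemma card_le_of_isotropic {ρ : Type} [Fintype ρ] (M : ρ → Row Q) (hM : LinearIndependent K M)
    (hiso : ∀ r r', form (M r) (M r') = 0) : Fintype.card ρ ≤ Fintype.card Q := by
  classical
  -- Time reversal with the "Z" and "X" halves exchanged, so that `M * Nᵀ` is the Gram matrix of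
  -- `form`.
  let N : Matrix ρ (Q ⊕ Q) K := Matrix.of fun r s => timeReversal (M r s.swap)
  have hMN : (Matrix.of M) * N.transpose = 0 := by
    ext r r'
    simpa [Matrix.mul_apply, N, form, Finset.sum_add_distrib] using hiso r r'
  have hN : LinearIndependent K N.row := by
    rw [Fintype.linearIndependent_iff] at hM ⊢
    intro c hc r
    -- `N` depends semilinearly on `M`, so a relation among its rows becomes one among those of `M`
    -- after time reversal of the coefficients.
    have h := hM (fun r => timeReversal (c r)) (by
      ext s
      have hs := congrArg timeReversal (congrFun hc s.swap)
      simpa [N, Finset.sum_apply, Matrix.row, timeReversal_involutive] using hs) r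
    simpa using h
  have h := Matrix.rank_add_rank_le_card_of_mul_eq_zero hMN
  rw [Matrix.rank_transpose, LinearIndependent.rank_matrix (M := Matrix.of M) hM,
    LinearIndependent.rank_matrix hN, Fintype.card_sum] at h
  omega

end Span

/-! ### Normal form of pairs together with isotropic rows -/

section Pairs

/-- The row of `Z` on `q` at `(0, q)` and of `X` on `q` at `(1, q)`. -/
def pairRow {Q : Type} [DecidableEq Q] (p : Fin 2 × Q) : Row Q :=
  if p.1 = 0 then rowZ p.2 else rowX p.2

/-- The Gram matrix of a family of symplectic pairs. -/
def pairForm {ι : Type} [DecidableEq ι] : Matrix (Fin 2 × ι) (Fin 2 × ι) K :=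
  Matrix.blockDiagonal fun _ => !![0, 1; 1, 0]

lemma pairForm_apply {ι : Type} [DecidableEq ι] (b b' : Fin 2) (i j : ι) :
    pairForm (b, i) (b', j) = if i = j then !![0, 1; 1, (0 : K)] b b' else 0 := rfl

variable {Q : Type} [DecidableEq Q] [Fintype Q]

lemma form_pairRow_left (b : Fin 2) (q : Q) (v : Row Q) :
    form (pairRow (b, q)) v =
      timeReversal (if b = 0 then v (Sum.inr q) else v (Sum.inl q)) := by
  unfold pairRow
  split_ifs with h
  · simp [form_rowZ_left]
  · simp [form_rowX_left]

lemma form_pairRow (p p' : Fin 2 × Q) : form (pairRow p) (pairRow p') = pairForm p p' := by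
  obtain ⟨b, q⟩ := p
  obtain ⟨b', q'⟩ := p'
  rw [form_pairRow_left, pairForm_apply]
  fin_cases b <;> fin_cases b' <;> simp [pairRow, rowZ, rowX, Pi.single_apply, apply_ite]

/-- Symplectic pairs and isotropic rows that are orthogonal to them can be mapped to the standard
pairs and into the span of the remaining `Z` operators. -/
lemma exists_circuit_map_basis {ι α : Type} [Fintype ι] [DecidableEq ι] [Fintype α]
    (e : ι ⊕ α ≃ Q) (w : Fin 2 × ι → Row Q) (r : α → Row Q)
    (hw : ∀ p p', form (w p) (w p') = pairForm p p') (hwr : ∀ p j, form (w p) (r j) = 0)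
    (hr : ∀ j j', form (r j) (r j') = 0) :
    ∃ G ∈ circuitSub Q, (∀ p, G (w p) = pairRow (p.1, e (Sum.inl p.2))) ∧
      ∀ j, G (r j) = ∑ j', G (r j) (Sum.inl (e (Sum.inr j'))) • rowZ (e (Sum.inr j')) := by
  classical
  set φ : ι ↪ Q := Function.Embedding.inl.trans e.toEmbedding with hφ
  set ψ : α ↪ Q := Function.Embedding.inr.trans e.toEmbedding with hψ
  have hex : ∀ (f : ι → Row Q) i, Function.extend φ f 0 (φ i) = f i := fun f i =>
    φ.injective.extend_apply f 0 i
  have hw' : ∀ b b' i j, form (w (b, i)) (w (b', j)) =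
      if i = j then !![0, 1; 1, (0 : K)] b b' else 0 := fun b b' i j => hw _ _
  obtain ⟨g₁, hg₁, h₁⟩ := exists_circuit_map_pairs (Finset.univ.map φ) Finset.univ
    (Finset.subset_univ _) (Function.extend φ (fun i => w (0, i)) 0)
    (Function.extend φ (fun i => w (1, i)) 0)
    (fun _ _ q hq => absurd (Finset.mem_univ q) hq)
    (fun _ _ q hq => absurd (Finset.mem_univ q) hq)
    (by
      simp only [Finset.mem_map, Finset.mem_univ, true_and, forall_exists_index,
        forall_apply_eq_imp_iff, hex, hw']
      simp)
    (by
      simp only [Finset.mem_map, Finset.mem_univ, true_and, forall_exists_index,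
        forall_apply_eq_imp_iff, hex, hw']
      simp)
    (by
      simp only [Finset.mem_map, Finset.mem_univ, true_and, forall_exists_index,
        forall_apply_eq_imp_iff, hex, hw']
      simp)
  have h₁w : ∀ b i, g₁ (w (b, i)) = pairRow (b, φ i) := fun b i => by
    have h := h₁ (φ i) (Finset.mem_map_of_mem φ (Finset.mem_univ i))
    rw [hex, hex] at h
    fin_cases b
    · exact h.1
    · exact h.2
  have hU := isElementary_circuitSubOn (Finset.univ : Finset Q)
  have hφψ : ∀ q, q ∉ Finset.univ.map ψ → ∃ i, φ i = q := fun q hq => by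
    obtain ⟨x, rfl⟩ := e.surjective q
    rcases x with i | j
    · exact ⟨i, rfl⟩
    · exact absurd (Finset.mem_map_of_mem ψ (Finset.mem_univ j)) hq
  have hnot : ∀ i j, ψ j ≠ φ i := fun i j h => by
    have := e.injective h
    simp at this
  obtain ⟨g₂, hg₂, h₂⟩ := exists_circuit_map_isotropic (Finset.univ.map ψ)
    (Submodule.span K (Set.range fun j => g₁ (r j)))
    (fun u hu => supportedOn_of_mem_span (fun j q hq => by
      obtain ⟨i, rfl⟩ := hφψ q hq
      have h0 := hwr (0, i) j
      have h1 := hwr (1, i) j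
      rw [← hU.form_apply hg₁, h₁w] at h0 h1
      exact ⟨eq_zero_of_form_rowX h1, eq_zero_of_form_rowZ h0⟩) hu)
    (fun u hu v hv => form_eq_zero_of_mem_span (fun j j' => by
      rw [hU.form_apply hg₁, hr]) hu hv)
    (by
      rw [Finset.card_map, Finset.card_univ]
      exact finrank_range_le_card _)
  refine ⟨g₂ * g₁, mul_mem hg₂.1.1 hg₁.1.1, fun p => ?_, fun j => ?_⟩
  · obtain ⟨b, i⟩ := p
    rw [LinearEquiv.mul_apply, h₁w]
    refine (isElementary_circuitSubOn _).apply_of_vanishesOn hg₂ fun q hq => ?_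
    obtain ⟨j, -, rfl⟩ := Finset.mem_map.1 (Finset.mem_coe.1 hq)
    fin_cases b <;> simp [pairRow, rowZ, rowX, hnot i j]
  · rw [LinearEquiv.mul_apply]
    obtain ⟨hx, hz⟩ := h₂ (g₁ (r j)) (Submodule.subset_span ⟨j, rfl⟩)
    set y := g₂ (g₁ (r j))
    ext s
    rw [Finset.sum_apply]
    rcases s with q | q
    · by_cases hq : q ∈ Finset.univ.map ψ
      · obtain ⟨j₀, -, rfl⟩ := Finset.mem_map.1 hq
        rw [Finset.sum_eq_single j₀]
        · simp [rowZ, hψ]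
        · intro j' _ hne
          have : ψ j₀ ≠ e (Sum.inr j') := fun h => hne (ψ.injective h).symm
          simp [rowZ, this]
        · simp
      · rw [hz q hq, Finset.sum_eq_zero]
        intro j' _
        have : q ≠ e (Sum.inr j') := fun h =>
          hq (h ▸ Finset.mem_map_of_mem ψ (Finset.mem_univ j'))
        simp [rowZ, this]
    · simp [hx q, rowZ]

end Pairs

/-! ### Splitting rows between receiver and sender -/

section Join

variable {c n : ℕ}

/-- The row with the given parts on the qubits of the receiver and of the sender. -/
def join (b : Row (Fin c)) (v : Row (Fin n)) : Row (FrameQubits c n)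
  | Sum.inl (Sum.inl i) => b (Sum.inl i)
  | Sum.inl (Sum.inr i) => v (Sum.inl i)
  | Sum.inr (Sum.inl i) => b (Sum.inr i)
  | Sum.inr (Sum.inr i) => v (Sum.inr i)

lemma join_ext {u u' : Row (FrameQubits c n)}
    (h1 : ∀ i, u (Sum.inl (Sum.inl i)) = u' (Sum.inl (Sum.inl i)))
    (h2 : ∀ i, u (Sum.inl (Sum.inr i)) = u' (Sum.inl (Sum.inr i)))
    (h3 : ∀ i, u (Sum.inr (Sum.inl i)) = u' (Sum.inr (Sum.inl i)))
    (h4 : ∀ i, u (Sum.inr (Sum.inr i)) = u' (Sum.inr (Sum.inr i))) : u = u' := by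
  ext s
  rcases s with (i | i) | (i | i)
  exacts [h1 i, h2 i, h3 i, h4 i]

lemma form_join (b b' : Row (Fin c)) (v v' : Row (Fin n)) :
    form (join b v) (join b' v') = form b b' + form v v' := by
  simp [form, Fintype.sum_sum_type, join]

lemma apply_map_join (g : Gate (Fin n)) (b : Row (Fin c)) (v : Row (Fin n)) :
    (g.map Function.Embedding.inr).apply (join b v) = join b (g.apply v) := by
  match g with
  | .finite (.cnot i j h l) =>
    apply join_ext <;> intro q <;>
      simp [Gate.map, FiniteGate.map, Gate.apply, FiniteGate.apply, join, Pi.single_apply]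
  | .finite (.hadamard i) =>
    apply join_ext <;> intro q <;>
      simp [Gate.map, FiniteGate.map, Gate.apply, FiniteGate.apply, Equiv.swap_apply_def] <;>
      (try split_ifs) <;> simp_all [join]
  | .finite (.phase i) =>
    apply join_ext <;> intro q <;>
      simp [Gate.map, FiniteGate.map, Gate.apply, FiniteGate.apply, join, Pi.single_apply]
  | .finite (.cphase i j h l) =>
    apply join_ext <;> intro q <;>
      simp [Gate.map, FiniteGate.map, Gate.apply, FiniteGate.apply, join, Pi.single_apply]
  | .finite (.cphaseSelf i l h) =>
    apply join_ext <;> intro q <;>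
      simp [Gate.map, FiniteGate.map, Gate.apply, FiniteGate.apply, join, Pi.single_apply]
  | .infinite i f h =>
    apply join_ext <;> intro q <;>
      simp [Gate.map, Gate.apply, join, Function.update_apply]

lemma runRow_onSender (E : List (Gate (Fin n))) (b : Row (Fin c)) (v : Row (Fin n)) :
    runRow (onSender E) (join b v) = join b (runRow E v) := by
  induction E generalizing v with
  | nil => rfl
  | cons g E ih =>
    change runRow (onSender E) ((g.map Function.Embedding.inr).apply (join b v)) = _
    rw [apply_map_join, ih, runRow_cons]

end Join

/-! ### Decoder, logical rows and encoder -/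

section Main

variable {n c a m : ℕ}

/-- The part of the unencoded stabilizer on the receiver's qubits. -/
def receiverRow : GenIdx c a → Row (Fin c)
  | Sum.inl p => pairRow p
  | Sum.inr _ => 0

/-- The part of the unencoded stabilizer on the sender's qubits. -/
def senderRow (e : (Fin c ⊕ Fin a) ⊕ Fin m ≃ Fin n) : GenIdx c a → Row (Fin n)
  | Sum.inl p => pairRow (p.1, e (Sum.inl (Sum.inl p.2)))
  | Sum.inr j => rowZ (e (Sum.inl (Sum.inr j)))

lemma rowZ_inl (i : Fin c) : (rowZ (Sum.inl i) : Row (FrameQubits c n)) = join (rowZ i) 0 := by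
  apply join_ext <;> intro q <;> simp [rowZ, join, Pi.single_apply]

lemma rowX_inl (i : Fin c) : (rowX (Sum.inl i) : Row (FrameQubits c n)) = join (rowX i) 0 := by
  apply join_ext <;> intro q <;> simp [rowX, join, Pi.single_apply]

lemma rowZ_inr (i : Fin n) : (rowZ (Sum.inr i) : Row (FrameQubits c n)) = join 0 (rowZ i) := by
  apply join_ext <;> intro q <;> simp [rowZ, join, Pi.single_apply]

lemma rowX_inr (i : Fin n) : (rowX (Sum.inr i) : Row (FrameQubits c n)) = join 0 (rowX i) := by
  apply join_ext <;> intro q <;> simp [rowX, join, Pi.single_apply]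

lemma join_add_join (b b' : Row (Fin c)) (v v' : Row (Fin n)) :
    join b v + join b' v' = join (b + b') (v + v') := by
  apply join_ext <;> intro q <;> rfl

lemma pairRow_inl (p : Fin 2 × Fin c) :
    (pairRow (p.1, Sum.inl p.2) : Row (FrameQubits c n)) = join (pairRow p) 0 := by
  unfold pairRow
  split_ifs
  · exact rowZ_inl p.2
  · exact rowX_inl p.2

lemma pairRow_inr (b : Fin 2) (i : Fin n) :
    (pairRow (b, Sum.inr i) : Row (FrameQubits c n)) = join 0 (pairRow (b, i)) := by
  unfold pairRow
  split_ifs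
  · exact rowZ_inr i
  · exact rowX_inr i

lemma initialStabilizer_apply (e : (Fin c ⊕ Fin a) ⊕ Fin m ≃ Fin n) (r : GenIdx c a) :
    initialStabilizer e r = join (receiverRow r) (senderRow e r) := by
  rcases r with ⟨b, i⟩ | j
  · have h : initialStabilizer e (Sum.inl (b, i)) = pairRow (b, Sum.inl i) +
        pairRow (b, Sum.inr (e (Sum.inl (Sum.inl i)))) := by
      fin_cases b <;> rfl
    rw [h, pairRow_inl (b, i), pairRow_inr, join_add_join, add_zero, zero_add]
    rfl
  · exact rowZ_inr _

lemma initialInfo_eq_pairRow (e : (Fin c ⊕ Fin a) ⊕ Fin m ≃ Fin n) (r : Fin 2 × Fin m) :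
    initialInfo e r = pairRow (r.1, Sum.inr (e (Sum.inr r.2))) := rfl

lemma initialInfo_apply (e : (Fin c ⊕ Fin a) ⊕ Fin m ≃ Fin n) (r : Fin 2 × Fin m) :
    initialInfo e r = join 0 (pairRow (r.1, e (Sum.inr r.2))) :=
  pairRow_inr _ _

/-- The receiver's halves have the Gram matrix prescribed for `H`, so joining the two doubles every
product to 0. -/
lemma form_receiverRow (r r' : GenIdx c a) :
    form (receiverRow r) (receiverRow r') = standardForm c a r r' := by
  rcases r with p | j <;> rcases r' with p' | j'
  · exact form_pairRow p p'
  · simp [receiverRow, standardForm, form]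
  · simp [receiverRow, standardForm, form]
  · simp [receiverRow, standardForm, form]

lemma form_fromCols (Z X : Matrix (GenIdx c a) (Fin n) K) (r r' : GenIdx c a) :
    form (Matrix.fromCols Z X r) (Matrix.fromCols Z X r') =
      shiftedSymplecticMatrix Z X r r' := by
  simp [form, shiftedSymplecticMatrix, Matrix.mul_apply, Finset.sum_add_distrib]

/-- A finite-depth operation that maps an isotropic stabilizer off the information qubits. -/
lemma exists_decoder (e : (Fin c ⊕ Fin a) ⊕ Fin m ≃ Fin n)
    (S : GenIdx c a → Row (FrameQubits c n)) (hS : ∀ r r', form (S r) (S r') = 0) :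
    ∃ g ∈ finiteSubOn (Finset.univ : Finset (FrameQubits c n)),
      ∀ (p : Fin 2 × Fin m) (r : GenIdx c a), form (initialInfo e p) (g (S r)) = 0 := by
  -- With no information qubits there is no spare qubit, but also nothing to clear. Otherwise an
  -- information qubit is the spare one.
  rcases Nat.eq_zero_or_pos m with rfl | hm
  · exact ⟨1, one_mem _, fun p => p.2.elim0⟩
  set φ : Fin m ↪ FrameQubits c n :=
    (Function.Embedding.inr.trans e.toEmbedding).trans Function.Embedding.inr with hφ
  have hmem : ∀ j, φ j ∉ (Finset.univ.map φ)ᶜ := fun j h =>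
    Finset.mem_compl.1 h (Finset.mem_map_of_mem φ (Finset.mem_univ j))
  have hn : c + a + m = n := by simpa using Fintype.card_congr e
  obtain ⟨g, hg, h⟩ := exists_finite_map_isotropic ((Finset.univ.map φ)ᶜ)
    (fun h => hmem ⟨0, hm⟩ (h ▸ Finset.mem_univ _)) (Submodule.span K (Set.range S))
    (fun u hu v hv => form_eq_zero_of_mem_span hS hu hv) (by
      refine (finrank_range_le_card S).trans ?_
      rw [Finset.card_compl, Finset.card_map]
      simp
      omega)
  refine ⟨g, hg, fun p r => ?_⟩
  obtain ⟨hx, hz⟩ := h (S r) (Submodule.subset_span ⟨r, rfl⟩)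
  have hz' : g (S r) (Sum.inl (Sum.inr (e (Sum.inr p.2)))) = 0 := hz _ (hmem p.2)
  rw [initialInfo_eq_pairRow, form_pairRow_left, hx, hz', ite_self, map_zero]

/-- Laurent coefficients of stabilizer generators that cancel the receiver's part of a row. -/
lemma exists_cancel_receiver (H : GenIdx c a → Row (Fin n)) (v : Row (FrameQubits c n))
    (hv : ∀ s, v s ∈ laurentSubring) :
    ∃ (l : GenIdx c a → Laurent) (w : Row (Fin n)), (∀ j, l (Sum.inr j) = 0) ∧
      v + ∑ r, Laurent.toK (l r) • join (receiverRow r) (H r) = join 0 w := by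
  choose f hf using fun s => mem_laurentSubring.1 (hv s)
  -- On the receiver the ebit generators are the standard `Z` and `X` rows, so the entries of `v`
  -- there are the coefficients that cancel them.
  let l : GenIdx c a → Laurent := Sum.elim
    (fun p => if p.1 = 0 then f (Sum.inl (Sum.inl p.2)) else f (Sum.inr (Sum.inl p.2))) 0
  refine ⟨l, fun s => (v + ∑ r, Laurent.toK (l r) • join (receiverRow r) (H r))
    (Sum.map Sum.inr Sum.inr s), fun j => rfl, ?_⟩
  apply join_ext <;> intro i
  · simp [join, Finset.sum_apply, Fintype.sum_sum_type, Fintype.sum_prod_type, l, receiverRow,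
      pairRow, rowZ, rowX, Pi.single_apply, hf, CharTwo.add_self_eq_zero]
  · rfl
  · simp [join, Finset.sum_apply, Fintype.sum_sum_type, Fintype.sum_prod_type, l, receiverRow,
      pairRow, rowZ, rowX, Pi.single_apply, hf, CharTwo.add_self_eq_zero]
  · rfl

/-- An operation whose inverse encodes the stream into the given stabilizer and logical rows. -/
lemma exists_encoder (e : (Fin c ⊕ Fin a) ⊕ Fin m ≃ Fin n) (H : GenIdx c a → Row (Fin n))
    (w : Fin 2 × Fin m → Row (Fin n))
    (hH : ∀ r r', form (H r) (H r') = standardForm c a r r')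
    (hww : ∀ p p', form (w p) (w p') = pairForm p p') (hwH : ∀ p r, form (w p) (H r) = 0) :
    ∃ G ∈ circuitSub (Fin n), (∀ p, G (H (Sum.inl p)) = senderRow e (Sum.inl p)) ∧
      (∀ p, G (w p) = pairRow (p.1, e (Sum.inr p.2))) ∧
      ∀ j, ∃ z : Fin a → K, G (H (Sum.inr j)) = ∑ j', z j' • senderRow e (Sum.inr j') := by
  -- Ebits and information qubits both carry symplectic pairs; the ancillas carry the isotropic
  -- rest.
  let e' : (Fin c ⊕ Fin m) ⊕ Fin a ≃ Fin n :=
    ((Equiv.sumAssoc _ _ _).trans ((Equiv.sumCongr (Equiv.refl _) (Equiv.sumComm _ _)).trans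
      (Equiv.sumAssoc _ _ _).symm)).trans e
  let W : Fin 2 × (Fin c ⊕ Fin m) → Row (Fin n) := fun p =>
    Sum.elim (fun i => H (Sum.inl (p.1, i))) (fun j => w (p.1, j)) p.2
  obtain ⟨G, hG, hGW, hGr⟩ := exists_circuit_map_basis e' W (fun j => H (Sum.inr j))
    (by
      rintro ⟨b, i | i⟩ ⟨b', j | j⟩
      · refine (hH _ _).trans ?_
        simp [standardForm, pairForm, Matrix.blockDiagonal_apply]
      · refine (form_comm_eq_zero (hwH _ _)).trans ?_
        simp [pairForm_apply]
      · refine (hwH _ _).trans ?_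
        simp [pairForm_apply]
      · refine (hww _ _).trans ?_
        simp [pairForm_apply])
    (by
      rintro ⟨b, i | i⟩ j
      · refine (hH _ _).trans ?_
        simp [standardForm]
      · exact hwH _ _)
    (fun j j' => by
      refine (hH _ _).trans ?_
      simp [standardForm])
  exact ⟨G, hG, fun p => hGW (p.1, Sum.inl p.2), fun p => hGW (p.1, Sum.inr p.2),
    fun j => ⟨_, hGr j⟩⟩

/-- A left kernel vector of `R` is also one of `R * M`. -/
lemma isUnit_of_linearIndependent_mul {ρ κ : Type} [Fintype ρ] [DecidableEq ρ]
    (R : Matrix ρ ρ K) (M : Matrix ρ κ K) (h : LinearIndependent K (R * M).row) : IsUnit R := by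
  rw [← Matrix.linearIndependent_rows_iff_isUnit, ← Matrix.vecMul_injective_iff]
  rw [← Matrix.vecMul_injective_iff] at h
  intro x y hxy
  apply h
  simp only [← Matrix.vecMul_vecMul]
  exact congrArg (fun z => Matrix.vecMul z M) hxy

end Main

end QConv

end

/-! ### Assembly of encoder and decoder -/

theorem mainTheorem2 (n c a : ℕ) (k : ℤ) (ha : (a : ℤ) = n - k - 2 * c)
    (Z X : Matrix (QConv.GenIdx c a) (Fin n) QConv.K)
    (hrank : LinearIndependent QConv.K (Matrix.fromCols Z X).row)
    (hΩ : QConv.shiftedSymplecticMatrix Z X = QConv.standardForm c a) :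
    ∃ (m : ℕ) (e : (Fin c ⊕ Fin a) ⊕ Fin m ≃ Fin n)
      (E : List (QConv.Gate (Fin n)))
      (F : List (QConv.FiniteGate (QConv.FrameQubits c n))),
      (m : ℤ) = k + c ∧
      QConv.IsOnline E ∧
      QConv.Encodes e E (Matrix.fromCols Z X) ∧
      QConv.IsOnline (F.map QConv.Gate.finite) ∧
      QConv.IsFiniteDepth (F.map QConv.Gate.finite) ∧
      QConv.Decodes e E (F.map QConv.Gate.finite) := by
  open QConv in
  set H : GenIdx c a → Row (Fin n) := Matrix.fromCols Z X with hH
  have hHform : ∀ r r', form (H r) (H r') = standardForm c a r r' := fun r r' => by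
    rw [hH, form_fromCols, hΩ]
  set S : GenIdx c a → Row (FrameQubits c n) := fun r => join (receiverRow r) (H r) with hS
  have hSiso : ∀ r r', form (S r) (S r') = 0 := fun r r' => by
    rw [hS, form_join, form_receiverRow, hHform, CharTwo.add_self_eq_zero]
  have hSlin : LinearIndependent K S := by
    apply LinearIndependent.of_comp (LinearMap.funLeft K K (Sum.map Sum.inr Sum.inr))
    convert hrank using 1
    ext r s
    rcases s with q | q <;> rfl
  have hcard := card_le_of_isotropic S hSlin hSiso
  simp only [Fintype.card_sum, Fintype.card_prod, Fintype.card_fin] at hcard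
  -- The isotropic bound reads `2c + a ≤ c + n`, so this subtraction does not truncate.
  obtain ⟨m, hm⟩ : ∃ m : ℕ, c + a + m = n := ⟨n - (c + a), by omega⟩
  -- Any assignment of roles works.
  have e : (Fin c ⊕ Fin a) ⊕ Fin m ≃ Fin n := Fintype.equivOfCardEq (by simpa using hm)
  obtain ⟨g, hg, hgS⟩ := exists_decoder e S hSiso
  have hU := isElementary_finiteSubOn (Finset.univ : Finset (FrameQubits c n))
  have hgg : ∀ u, g (g⁻¹ u) = u := fun u => g.apply_symm_apply u
  have hinfo : ∀ p s, initialInfo e p s ∈ laurentSubring := fun p s => by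
    rw [initialInfo_eq_pairRow]
    unfold pairRow rowZ rowX
    split_ifs <;> rw [Pi.single_apply] <;> split_ifs <;> first | exact one_mem _ | exact zero_mem _
  choose l w hl hw using fun p => exists_cancel_receiver H (g⁻¹ (initialInfo e p))
    (hU.apply_mem _ (inv_mem hg) _ (hinfo p))
  have hvS : ∀ p r, form (g⁻¹ (initialInfo e p)) (S r) = 0 := fun p r => by
    rw [← hU.form_apply hg, hgg, hgS]
  have hwS : ∀ p r, form (join 0 (w p)) (S r) = 0 := fun p r => by
    rw [← hw, form_add_left, hvS, zero_add]
    exact form_comm_eq_zero (form_sum_right _ _ _ fun r' => hSiso r r')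
  have hwH : ∀ p r, form (w p) (H r) = 0 := fun p r => by
    have h := hwS p r
    rw [hS, form_join] at h
    simpa [form] using h
  have hww : ∀ p p', form (w p) (w p') = pairForm p p' := fun p p' => by
    have h : form (join (0 : Row (Fin c)) (w p)) (join 0 (w p')) = pairForm p p' := by
      -- The rows `join 0 (w p)` differ from the pulled-back logical operators by elements of the
      -- span of `S`, which are orthogonal to all rows involved; what remains is the Gram matrix of
      -- the original logical operators.
      conv_lhs => rw [← hw p']
      rw [form_add_right, form_sum_right _ _ _ fun r => hwS p r, add_zero, ← hw p,
        form_add_left, form_comm_eq_zero (form_sum_right _ _ _ fun r => hvS p' r), add_zero,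
        hU.form_apply (inv_mem hg), initialInfo_eq_pairRow, initialInfo_eq_pairRow, form_pairRow]
      simp [pairForm, Matrix.blockDiagonal_apply]
    rw [form_join] at h
    simpa [form] using h
  obtain ⟨G, hG, hGH, hGw, hGr⟩ := exists_encoder e H w hHform hww hwH
  obtain ⟨E, hE⟩ := inv_mem hG
  obtain ⟨⟨⟨F, hF⟩, -⟩, -⟩ := hg
  have hGG : ∀ u, G⁻¹ (G u) = u := fun u => G.symm_apply_apply u
  have hrunS : ∀ r, run (onSender E) (initialStabilizer e) r =
      join (receiverRow r) (G⁻¹ (senderRow e r)) := fun r => by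
    change runRow (onSender E) (initialStabilizer e r) = _
    rw [initialStabilizer_apply, runRow_onSender, hE]
  have hrunSinl : ∀ p, run (onSender E) (initialStabilizer e) (Sum.inl p) = S (Sum.inl p) :=
    fun p => by rw [hrunS, ← hGH, hGG]
  refine ⟨m, e, E, F, by omega, isOnline _, ?_, isOnline _, isFiniteDepth_map_finite F, ?_⟩
  · choose z hz using hGr
    -- Ebit rows of `H` are reproduced exactly; the isotropic rows are only combinations, with
    -- coefficients `z`, of the encoded ancilla rows.
    let R : Matrix (GenIdx c a) (GenIdx c a) K := Matrix.fromBlocks 1 0 0 (Matrix.of z)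
    have hsend : ∀ r s, senderPart (run (onSender E) (initialStabilizer e)) r s =
        G⁻¹ (senderRow e r) s := fun r s => by
      change run (onSender E) (initialStabilizer e) r (Sum.map Sum.inr Sum.inr s) = _
      rw [hrunS]
      rcases s with q | q <;> rfl
    have hR : Matrix.fromCols Z X =
        R * senderPart (run (onSender E) (initialStabilizer e)) := by
      ext r s
      change H r s = _
      simp only [Matrix.mul_apply, hsend]
      rcases r with p | j
      · simp [R, Matrix.one_apply, ← hGH]
      · rw [← hGG (H (Sum.inr j)), hz, map_sum]
        simp [R, Finset.sum_apply]
    exact ⟨R, isUnit_of_linearIndependent_mul R _ (by rw [← hR]; exact hrank), hR⟩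
  -- The coefficients that cancelled the receiver's part: `join 0 (w p)` is the pulled-back operator
  -- plus this combination of `S`, and decoding applies `g` to it.
  · refine ⟨Matrix.of l, ?_⟩
    ext p s
    have h1 : run (onSender E) (initialInfo e) p = join 0 (w p) := by
      change runRow (onSender E) (initialInfo e p) = _
      rw [initialInfo_apply, runRow_onSender, hE, ← hGw, hGG]
    have h2 : run (F.map Gate.finite) (run (onSender E) (initialInfo e)) p =
        initialInfo e p + ∑ r, Laurent.toK (l p r) • g (S r) := by
      change runRow (F.map Gate.finite) (run (onSender E) (initialInfo e) p) = _
      rw [hF, h1, ← hw, map_add, hgg, map_sum]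
      simp only [map_smul, hS]
    rw [h2]
    simp only [Pi.add_apply, Finset.sum_apply, Pi.smul_apply, smul_eq_mul, Matrix.add_apply,
      Matrix.mul_apply, Matrix.map_apply, Matrix.of_apply]
    congr 1
    refine Finset.sum_congr rfl fun r _ => ?_
    rcases r with q | j
    · have h3 : run (F.map Gate.finite) (run (onSender E) (initialStabilizer e)) (Sum.inl q) =
          g (S (Sum.inl q)) := by
        change runRow (F.map Gate.finite) (run (onSender E) (initialStabilizer e) (Sum.inl q)) = _
        rw [hrunSinl, hF]
      rw [h3]
    -- The encoded ancilla rows need not equal the corresponding rows of `S`, but their coefficients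
    -- are 0.
    · rw [hl, map_zero, zero_mul, zero_mul]
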